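/- Let $(N,\preccurlyeq,F)$ be a description of a simply dependent multimodal logic: $N$ is a finite set of natural numbers, $\preccurlyeq$ is a partial order on $N$, $F:N\to 2^{\{\mathsf D,\mathsf T,\mathsf 4\}}$, and whenever $j\preccurlyeq i$ and $\mathsf 4\in F(j)$ then $\mathsf 4\in F(i)$. Here $\mathsf D=\neg\Box\bot$, $\mathsf T=\Box A\to A$, $\mathsf 4=\Box A\to\Box\Box A$. Write $\mathsf{KAx}\subseteq F(i)$ if the unimodal logic $\mathsf K+F(i)$ contains $\mathsf{Ax}$; that is, $\mathsf{Ax}\in F(i)$, or $\mathsf{Ax}=\mathsf D$ and $\mathsf T\in F(i)$. Put ${\uparrow}j=\{i\in N: j\preccurlyeq i\}$, ${\uparrow}^{\mathsf 4}j=\{i\in{\uparrow}j:\mathsf{K4}\subseteq F(i)\}$ and ${\uparrow}^{\neg\mathsf 4}j={\uparrow}j\setminus{\uparrow}^{\mathsf 4}j$. Formulae are built from countably many atoms by $\bot,\wedge,\vee,\to$ and $\Box_i$ ($i\in N$). Sequents $\Gamma\vdash\Delta$ consist of finite multisets of formulae. All four calculi below contain the propositional rules of classical logic in context-sharing form, namely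 axioms $\Gamma,P\vdash P,\Delta$ ($P$ atomic) and $\Gamma,\bot\vdash\Delta$ and the usual invertible left and right rules for $\wedge,\vee,\to$ (for example, $\Gamma\vdash A\to B,\Delta$ from $\Gamma,A\vdash B,\Delta$); they contain no structural rules. They have the following modal rules. * $\mathsf{SC}_{(N,\preccurlyeq,F)}$ acts on sequents. For families $(\Gamma_j)_{j\in N},(\Sigma_j)_{j\in N}$ of finite multisets of formulae and multisets $\Omega,\Xi$: $\mathsf k_i$ ($i\in N$): from $\{\Box_j\Gamma_j,\Box_j\Sigma_j,\Sigma_j: j\in{\uparrow}^{\mathsf 4}i\},\{\Sigma_j:j\in{\uparrow}^{\neg\mathsf 4}i\}\vdash A$ infer $\Omega,\{\Box_j\Gamma_j,\Box_j\Sigma_j: j\in{\uparrow}^{\mathsf 4}i\},\{\Box_j\Sigma_j:j\in{\uparrow}^{\neg\mathsf 4}i\}\vdash\Box_iA,\Xi$; $\mathsf d_i$ ($\mathsf{KD}\subseteq F(i)$): the same with $A$ deleted from the premise and $\Box_iA$ from the conclusion; $\mathsf t_i$ ($\mathsf{KT}\subseteq F(i)$): from $\Omega,\{\Box_j\Sigma_j,\Sigma_j:j\in{\uparrow}i\}\vdash\Xi$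 infer $\Omega,\{\Box_j\Sigma_j:j\in{\uparrow}i\}\vdash\Xi$. * $\mathsf{NS}_{(N,\preccurlyeq,F)}$ acts on indexed nested sequents, i.e. finite trees $\Gamma\vdash\Delta,[G_1]^{i_1},\dots,[G_n]^{i_n}$ of sequents in which every nesting carries an index from $N$ and the nestings of a node form a multiset. The rules, including the propositional ones, apply at any node of the tree, the other nestings and nodes being left unchanged: $\Box_R$: from $\Gamma\vdash\Delta,[\;\vdash A]^i$ infer $\Gamma\vdash\Delta,\Box_iA$; $\Box_L$ ($j\preccurlyeq i$): from $\Gamma,\Box_iA\vdash\Delta,[\Sigma,A\vdash\Pi]^j$ infer $\Gamma,\Box_iA\vdash\Delta,[\Sigma\vdash\Pi]^j$; $\mathsf 4$ ($j\preccurlyeq i$, $\mathsf{K4}\subseteq F(i)$): from $\Gamma,\Box_iA\vdash\Delta,[\Sigma,\Box_iA\vdash\Pi]^j$ infer $\Gamma,\Box_iA\vdash\Delta,[\Sigma\vdash\Pi]^j$; $\mathsf d$ ($j\preccurlyeq i$, $\mathsf{KD}\subseteq F(j)$): from $\Gamma,\Box_iA\vdash\Delta,[A\vdash\;]^j$ infer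 $\Gamma,\Box_iA\vdash\Delta$; $\mathsf t$ ($j\preccurlyeq i$ for some $j$ with $\mathsf{KT}\subseteq F(j)$): from $\Gamma,\Box_iA,A\vdash\Delta$ infer $\Gamma,\Box_iA\vdash\Delta$. In $\Box_L$ and $\mathsf 4$ the nesting $[\Sigma\vdash\Pi]^j$ may itself have further nestings, which are left unchanged. * $\mathsf{LNS}_{(N,\preccurlyeq,F)}$ acts on linear nested sequents, i.e. non-empty finite lists of sequents, consecutive ones being separated by $/\!/^{k}$ or by a blocking operator $\backslash\!\backslash^{k}$ ($k\in N$). It has the same rules with the same side conditions, in the following form. Propositional rules and $\mathsf t$ apply to the last component, provided that it is the only one or is preceded by some $/\!/^{k}$. Reading from the conclusion to the premise, $\Box_R$ and $\mathsf d$ apply to such a last component too and append a new last component $\backslash\!\backslash^{i}\;\vdash A$, respectively $\backslash\!\backslash^{j}A\vdash$. The rules $\Box_L$ and $\mathsf 4$ apply to the last two components $\Gamma,\Box_iA\vdash\Delta\;\backslash\!\backslash^{j}\;\Sigma\vdash\Pi$, where the former is the first component or is preceded by some $/\!/^{k}$. Finally the rule $\mathsf{close}$ infers $\mathcal G\,\backslash\!\backslash^{k}\,\Gamma\vdash\Delta$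 from $\mathcal G\,/\!/^{k}\,\Gamma\vdash\Delta$. * $\mathsf{LbNS}_{(N,\preccurlyeq,F)}$ acts on labelled sequents $\mathcal R,X\vdash Y$, where $\mathcal R$ is a finite set of relation terms $xR_jy$ and $X,Y$ are finite multisets of labelled formulae $x:A$. It has the $\mathbb{TL}$-translations of the rules of $\mathsf{NS}_{(N,\preccurlyeq,F)}$, with the same side conditions: a node of the tree becomes a state variable $x$, a nesting $[\;]^j$ of $x$ becomes a relation term $xR_jy$, and $y$ is fresh when the nesting is created by a rule read from the conclusion to the premise. Here $\mathbb{TL}_x(\Upsilon)$ is obtained from an indexed nested sequent $\Upsilon$ by giving its nodes pairwise distinct state variables, the root being given $x$. Then the four systems are equivalent: for every sequent $\Gamma\vdash\Delta$ and every state variable $x$, the following are equivalent: $\Gamma\vdash\Delta$ is derivable in $\mathsf{NS}_{(N,\preccurlyeq,F)}$; it is derivable in $\mathsf{LNS}_{(N,\preccurlyeq,F)}$; it is derivable in $\mathsf{SC}_{(N,\preccurlyeq,F)}$; and $x:\Gamma\vdash x:\Delta$ is derivable in $\mathsf{LbNS}_{(N,\preccurlyeq,F)}$. Moreover, for every indexed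 nested sequent $\Upsilon$ and every choice of state variables, $\Upsilon$ is derivable in $\mathsf{NS}_{(N,\preccurlyeq,F)}$ if and only if $\mathbb{TL}_x(\Upsilon)$ is derivable in $\mathsf{LbNS}_{(N,\preccurlyeq,F)}$. -/

import Mathlib

namespace SDML

/-- The modal schemes `D : ¬□⊥`, `T : □A → A` and `4 : □A → □□A`. -/
inductive ModAx
  | D
  | T
  | four

/-- A description `(N, ≼, F)` of a simply dependent multimodal logic: a finite set `N` of natural
numbers, a partial order `≼` on `N` (unrelated to the order of `ℕ`), a set `F i` of modal schemes
for every `i ∈ N`, and transitive-closedness: if `j ≼ i` and `4` belongs to the component of `j`,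
then it belongs to the component of `i`.  (The component logic `K + F i` proves `4` exactly if
`4 ∈ F i`.) -/
structure Description where
  N : Finset ℕ
  le : N → N → Prop
  le_refl : ∀ i, le i i
  le_trans : ∀ i j k, le i j → le j k → le i k
  le_antisymm : ∀ i j, le i j → le j i → i = j
  F : N → Set ModAx
  transClosed : ∀ i j, le j i → ModAx.four ∈ F j → ModAx.four ∈ F i

/-- The indices of the modalities. -/
abbrev Description.Idx (L : Description) : Type := {i : ℕ // i ∈ L.N}

/-- `K Ax ⊆ F(i)`: the component logic `K + F i` contains the scheme `Ax`.  The only scheme among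
`D`, `T`, `4` that can be proved from others over `K` is `D`, which follows from `T`. -/
def Description.Has (L : Description) (i : L.Idx) : ModAx → Prop
  | .D => ModAx.D ∈ L.F i ∨ ModAx.T ∈ L.F i
  | .T => ModAx.T ∈ L.F i
  | .four => ModAx.four ∈ L.F i

open Classical in
/-- The upset `↑j = {i ∈ N : j ≼ i}`. -/
noncomputable def Description.up (L : Description) (j : L.Idx) : Finset L.Idx :=
  Finset.univ.filter fun i => L.le j i

open Classical in
/-- `{i ∈ N : j ≼ i, K4 ⊆ F(i)}`. -/
noncomputable def Description.up4 (L : Description) (j : L.Idx) : Finset L.Idx :=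
  (L.up j).filter fun i => L.Has i .four

open Classical in
/-- `{i ∈ N : j ≼ i, K4 ⊈ F(i)}`. -/
noncomputable def Description.upNot4 (L : Description) (j : L.Idx) : Finset L.Idx :=
  (L.up j).filter fun i => ¬ L.Has i .four

/-- Multimodal formulae with modalities indexed by `I`; negation is `A → ⊥`. -/
inductive Fml (I : Type) : Type
  | atom (p : ℕ)
  | bot
  | and (A B : Fml I)
  | or (A B : Fml I)
  | imp (A B : Fml I)
  | box (i : I) (A : Fml I)

/-- The multiset `□ᵢΓ`. -/
def boxes {I : Type} (i : I) (Γ : Multiset (Fml I)) : Multiset (Fml I) := Γ.map (Fml.box i)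

/-- A sequent `Γ ⊢ Δ` of finite multisets of formulae. -/
structure Sequent (I : Type) : Type where
  ant : Multiset (Fml I)
  suc : Multiset (Fml I)

/-- The instances (list of premises, conclusion) of the propositional rules of classical logic. -/
inductive PropRule {I : Type} : List (Sequent I) → Sequent I → Prop
  | init (Γ Δ : Multiset (Fml I)) (p : ℕ) :
      PropRule [] ⟨.atom p ::ₘ Γ, .atom p ::ₘ Δ⟩
  | botL (Γ Δ : Multiset (Fml I)) :
      PropRule [] ⟨.bot ::ₘ Γ, Δ⟩
  | andL (Γ Δ : Multiset (Fml I)) (A B : Fml I) :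
      PropRule [⟨A ::ₘ B ::ₘ Γ, Δ⟩] ⟨.and A B ::ₘ Γ, Δ⟩
  | andR (Γ Δ : Multiset (Fml I)) (A B : Fml I) :
      PropRule [⟨Γ, A ::ₘ Δ⟩, ⟨Γ, B ::ₘ Δ⟩] ⟨Γ, .and A B ::ₘ Δ⟩
  | orL (Γ Δ : Multiset (Fml I)) (A B : Fml I) :
      PropRule [⟨A ::ₘ Γ, Δ⟩, ⟨B ::ₘ Γ, Δ⟩] ⟨.or A B ::ₘ Γ, Δ⟩
  | orR (Γ Δ : Multiset (Fml I)) (A B : Fml I) :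
      PropRule [⟨Γ, A ::ₘ B ::ₘ Δ⟩] ⟨Γ, .or A B ::ₘ Δ⟩
  | impL (Γ Δ : Multiset (Fml I)) (A B : Fml I) :
      PropRule [⟨Γ, A ::ₘ Δ⟩, ⟨B ::ₘ Γ, Δ⟩] ⟨.imp A B ::ₘ Γ, Δ⟩
  | impR (Γ Δ : Multiset (Fml I)) (A B : Fml I) :
      PropRule [⟨A ::ₘ Γ, B ::ₘ Δ⟩] ⟨Γ, .imp A B ::ₘ Δ⟩

/-! ### The sequent calculus -/

/-- Derivability in the sequent calculus `SC_(N,≼,F)`.  In the modal rules `Γ` and `Θ` are families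
of multisets of formulae indexed by `N`. -/
inductive SC (L : Description) : Sequent L.Idx → Prop
  | prop (prems : List (Sequent L.Idx)) (S : Sequent L.Idx) :
      PropRule prems S → (∀ P ∈ prems, SC L P) → SC L S
  | k (i : L.Idx) (A : Fml L.Idx) (Γ Θ : L.Idx → Multiset (Fml L.Idx))
      (Ω Ξ : Multiset (Fml L.Idx)) :
      SC L ⟨(∑ j ∈ L.up4 i, (boxes j (Γ j) + boxes j (Θ j) + Θ j)) + ∑ j ∈ L.upNot4 i, Θ j,
        {A}⟩ →
      SC L ⟨Ω + (∑ j ∈ L.up4 i, (boxes j (Γ j) + boxes j (Θ j))) +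
          ∑ j ∈ L.upNot4 i, boxes j (Θ j),
        .box i A ::ₘ Ξ⟩
  | d (i : L.Idx) (Γ Θ : L.Idx → Multiset (Fml L.Idx)) (Ω Ξ : Multiset (Fml L.Idx)) :
      L.Has i .D →
      SC L ⟨(∑ j ∈ L.up4 i, (boxes j (Γ j) + boxes j (Θ j) + Θ j)) + ∑ j ∈ L.upNot4 i, Θ j, 0⟩ →
      SC L ⟨Ω + (∑ j ∈ L.up4 i, (boxes j (Γ j) + boxes j (Θ j))) +
          ∑ j ∈ L.upNot4 i, boxes j (Θ j), Ξ⟩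
  | t (i : L.Idx) (Θ : L.Idx → Multiset (Fml L.Idx)) (Ω Ξ : Multiset (Fml L.Idx)) :
      L.Has i .T →
      SC L ⟨Ω + ∑ j ∈ L.up i, (boxes j (Θ j) + Θ j), Ξ⟩ →
      SC L ⟨Ω + ∑ j ∈ L.up i, boxes j (Θ j), Ξ⟩

/-! ### Indexed nested sequents -/

/-- Indexed nested sequents `Γ ⊢ Δ, [G₁]^{i₁}, …, [Gₙ]^{iₙ}`.  The nestings form a multiset; they
are listed here, and the calculus below identifies lists that are permutations of each other. -/
inductive Nested (I : Type) : Type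
  | node (S : Sequent I) (nestings : List (I × Nested I))

/-- Nested sequents with one hole. -/
inductive NCtx (I : Type) : Type
  | hole
  | node (S : Sequent I) (j : I) (C : NCtx I) (nestings : List (I × Nested I))

/-- `Υ{G}`. -/
def NCtx.fill {I : Type} : NCtx I → Nested I → Nested I
  | .hole, G => G
  | .node S j C Λ, G => .node S ((j, C.fill G) :: Λ)

/-- Derivability in the indexed nested system `NS_(N,≼,F)`. -/
inductive NS (L : Description) : Nested L.Idx → Prop
  /-- The nestings of a node are a multiset. -/
  | exch (U : NCtx L.Idx) (S : Sequent L.Idx) (Λ Λ' : List (L.Idx × Nested L.Idx)) :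
      Λ.Perm Λ' → NS L (U.fill (.node S Λ)) → NS L (U.fill (.node S Λ'))
  | prop (U : NCtx L.Idx) (Λ : List (L.Idx × Nested L.Idx))
      (prems : List (Sequent L.Idx)) (S : Sequent L.Idx) :
      PropRule prems S → (∀ P ∈ prems, NS L (U.fill (.node P Λ))) → NS L (U.fill (.node S Λ))
  | boxL (U : NCtx L.Idx) (Λ Λ' : List (L.Idx × Nested L.Idx)) (i j : L.Idx) (A : Fml L.Idx)
      (Γ Δ Θ Ξ : Multiset (Fml L.Idx)) :
      L.le j i →
      NS L (U.fill (.node ⟨.box i A ::ₘ Γ, Δ⟩ ((j, .node ⟨A ::ₘ Θ, Ξ⟩ Λ') :: Λ))) →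
      NS L (U.fill (.node ⟨.box i A ::ₘ Γ, Δ⟩ ((j, .node ⟨Θ, Ξ⟩ Λ') :: Λ)))
  | boxR (U : NCtx L.Idx) (Λ : List (L.Idx × Nested L.Idx)) (i : L.Idx) (A : Fml L.Idx)
      (Γ Δ : Multiset (Fml L.Idx)) :
      NS L (U.fill (.node ⟨Γ, Δ⟩ ((i, .node ⟨0, {A}⟩ []) :: Λ))) →
      NS L (U.fill (.node ⟨Γ, .box i A ::ₘ Δ⟩ Λ))
  | d (U : NCtx L.Idx) (Λ : List (L.Idx × Nested L.Idx)) (i j : L.Idx) (A : Fml L.Idx)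
      (Γ Δ : Multiset (Fml L.Idx)) :
      L.le j i → L.Has j .D →
      NS L (U.fill (.node ⟨.box i A ::ₘ Γ, Δ⟩ ((j, .node ⟨{A}, 0⟩ []) :: Λ))) →
      NS L (U.fill (.node ⟨.box i A ::ₘ Γ, Δ⟩ Λ))
  | t (U : NCtx L.Idx) (Λ : List (L.Idx × Nested L.Idx)) (i j : L.Idx) (A : Fml L.Idx)
      (Γ Δ : Multiset (Fml L.Idx)) :
      L.le j i → L.Has j .T →
      NS L (U.fill (.node ⟨.box i A ::ₘ A ::ₘ Γ, Δ⟩ Λ)) →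
      NS L (U.fill (.node ⟨.box i A ::ₘ Γ, Δ⟩ Λ))
  | four (U : NCtx L.Idx) (Λ Λ' : List (L.Idx × Nested L.Idx)) (i j : L.Idx) (A : Fml L.Idx)
      (Γ Δ Θ Ξ : Multiset (Fml L.Idx)) :
      L.le j i → L.Has i .four →
      NS L (U.fill (.node ⟨.box i A ::ₘ Γ, Δ⟩ ((j, .node ⟨.box i A ::ₘ Θ, Ξ⟩ Λ') :: Λ))) →
      NS L (U.fill (.node ⟨.box i A ::ₘ Γ, Δ⟩ ((j, .node ⟨Θ, Ξ⟩ Λ') :: Λ)))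

/-! ### Linear nested sequents, in blocked form -/

/-- Linear nested sequents: finite non-empty lists of sequents, consecutive ones being separated
by the ordinary nesting operator `//[k]` or by the auxiliary (blocking) operator `\\[k]`. -/
inductive LinNested (I : Type) : Type
  | single (S : Sequent I)
  | nest (G : LinNested I) (k : I) (S : Sequent I)
  | blocked (G : LinNested I) (k : I) (S : Sequent I)

/-- The context `𝒢 //[k] _`, where `𝒢` may be absent. -/
inductive LinCtx (I : Type) : Type
  | empty
  | nest (G : LinNested I) (k : I)

/-- `𝒢 //[k] S`, respectively `S`. -/
def LinCtx.fill {I : Type} : LinCtx I → Sequent I → LinNested I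
  | .empty, S => .single S
  | .nest G k, S => .nest G k S

/-- Derivability in the end-active, blocked form linear nested system `LNS_(N,≼,F)`. -/
inductive LNS (L : Description) : LinNested L.Idx → Prop
  | prop (U : LinCtx L.Idx) (prems : List (Sequent L.Idx)) (S : Sequent L.Idx) :
      PropRule prems S → (∀ P ∈ prems, LNS L (U.fill P)) → LNS L (U.fill S)
  | boxR (U : LinCtx L.Idx) (i : L.Idx) (A : Fml L.Idx) (Γ Δ : Multiset (Fml L.Idx)) :
      LNS L (.blocked (U.fill ⟨Γ, Δ⟩) i ⟨0, {A}⟩) →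
      LNS L (U.fill ⟨Γ, .box i A ::ₘ Δ⟩)
  | boxL (U : LinCtx L.Idx) (i j : L.Idx) (A : Fml L.Idx)
      (Γ Δ Θ Ξ : Multiset (Fml L.Idx)) :
      L.le j i →
      LNS L (.blocked (U.fill ⟨.box i A ::ₘ Γ, Δ⟩) j ⟨A ::ₘ Θ, Ξ⟩) →
      LNS L (.blocked (U.fill ⟨.box i A ::ₘ Γ, Δ⟩) j ⟨Θ, Ξ⟩)
  | close (G : LinNested L.Idx) (k : L.Idx) (S : Sequent L.Idx) :
      LNS L (.nest G k S) → LNS L (.blocked G k S)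
  | d (U : LinCtx L.Idx) (i j : L.Idx) (A : Fml L.Idx) (Γ Δ : Multiset (Fml L.Idx)) :
      L.le j i → L.Has j .D →
      LNS L (.blocked (U.fill ⟨.box i A ::ₘ Γ, Δ⟩) j ⟨{A}, 0⟩) →
      LNS L (U.fill ⟨.box i A ::ₘ Γ, Δ⟩)
  | t (U : LinCtx L.Idx) (i j : L.Idx) (A : Fml L.Idx) (Γ Δ : Multiset (Fml L.Idx)) :
      L.le j i → L.Has j .T →
      LNS L (U.fill ⟨.box i A ::ₘ A ::ₘ Γ, Δ⟩) →
      LNS L (U.fill ⟨.box i A ::ₘ Γ, Δ⟩)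
  | four (U : LinCtx L.Idx) (i j : L.Idx) (A : Fml L.Idx)
      (Γ Δ Θ Ξ : Multiset (Fml L.Idx)) :
      L.le j i → L.Has i .four →
      LNS L (.blocked (U.fill ⟨.box i A ::ₘ Γ, Δ⟩) j ⟨.box i A ::ₘ Θ, Ξ⟩) →
      LNS L (.blocked (U.fill ⟨.box i A ::ₘ Γ, Δ⟩) j ⟨Θ, Ξ⟩)

/-! ### Labelled nested sequents -/

/-- Labelled sequents `R, X ⊢ Y`.  The state variables are the natural numbers, the relation term
`x R_j y` is the triple `(x, j, y)`, and the labelled formula `x : A` is the pair `(x, A)`. -/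
structure LabSequent (I : Type) : Type where
  rel : Finset (ℕ × I × ℕ)
  ant : Multiset (ℕ × Fml I)
  suc : Multiset (ℕ × Fml I)

/-- The multiset `x : Γ`. -/
def lab {I : Type} (x : ℕ) (Γ : Multiset (Fml I)) : Multiset (ℕ × Fml I) :=
  Γ.map fun A => (x, A)

/-- The state variable `y` does not occur in `R, X ⊢ Y`. -/
def LabSequent.Fresh {I : Type} (y : ℕ) (S : LabSequent I) : Prop :=
  (∀ r ∈ S.rel, r.1 ≠ y ∧ r.2.2 ≠ y) ∧ (∀ a ∈ S.ant, a.1 ≠ y) ∧ (∀ a ∈ S.suc, a.1 ≠ y)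

/-- Derivability in the labelled nested system `LbNS_(N,≼,F)`.  Read from the conclusion to the
premises, every rule preserves that the relation set is a tree and that it connects all labels, so
derivations of labelled nested sequents consist of labelled nested sequents. -/
inductive LbNS (L : Description) : LabSequent L.Idx → Prop
  | prop (R : Finset (ℕ × L.Idx × ℕ)) (X Y : Multiset (ℕ × Fml L.Idx)) (x : ℕ)
      (prems : List (Sequent L.Idx)) (S : Sequent L.Idx) :
      PropRule prems S →
      (∀ P ∈ prems, LbNS L ⟨R, X + lab x P.ant, Y + lab x P.suc⟩) →
      LbNS L ⟨R, X + lab x S.ant, Y + lab x S.suc⟩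
  | boxL (R : Finset (ℕ × L.Idx × ℕ)) (X Y : Multiset (ℕ × Fml L.Idx)) (x y : ℕ)
      (i j : L.Idx) (A : Fml L.Idx) :
      L.le j i → (x, j, y) ∈ R →
      LbNS L ⟨R, (y, A) ::ₘ (x, .box i A) ::ₘ X, Y⟩ →
      LbNS L ⟨R, (x, .box i A) ::ₘ X, Y⟩
  | boxR (R : Finset (ℕ × L.Idx × ℕ)) (X Y : Multiset (ℕ × Fml L.Idx)) (x y : ℕ)
      (i : L.Idx) (A : Fml L.Idx) :
      LabSequent.Fresh y ⟨R, X, (x, .box i A) ::ₘ Y⟩ →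
      LbNS L ⟨insert (x, i, y) R, X, (y, A) ::ₘ Y⟩ →
      LbNS L ⟨R, X, (x, .box i A) ::ₘ Y⟩
  | d (R : Finset (ℕ × L.Idx × ℕ)) (X Y : Multiset (ℕ × Fml L.Idx)) (x y : ℕ)
      (i j : L.Idx) (A : Fml L.Idx) :
      L.le j i → L.Has j .D →
      LabSequent.Fresh y ⟨R, (x, .box i A) ::ₘ X, Y⟩ →
      LbNS L ⟨insert (x, j, y) R, (y, A) ::ₘ (x, .box i A) ::ₘ X, Y⟩ →
      LbNS L ⟨R, (x, .box i A) ::ₘ X, Y⟩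
  | t (R : Finset (ℕ × L.Idx × ℕ)) (X Y : Multiset (ℕ × Fml L.Idx)) (x : ℕ)
      (i j : L.Idx) (A : Fml L.Idx) :
      L.le j i → L.Has j .T →
      LbNS L ⟨R, (x, A) ::ₘ (x, .box i A) ::ₘ X, Y⟩ →
      LbNS L ⟨R, (x, .box i A) ::ₘ X, Y⟩
  | four (R : Finset (ℕ × L.Idx × ℕ)) (X Y : Multiset (ℕ × Fml L.Idx)) (x y : ℕ)
      (i j : L.Idx) (A : Fml L.Idx) :
      L.le j i → L.Has i .four → (x, j, y) ∈ R →
      LbNS L ⟨R, (y, .box i A) ::ₘ (x, .box i A) ::ₘ X, Y⟩ →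
      LbNS L ⟨R, (x, .box i A) ::ₘ X, Y⟩

/-- `TL x U V S`: the labelled sequent `S` is the translation `TL_x(U)` of the nested sequent `U`
for some choice of pairwise distinct state variables for the nodes of `U`; the root is labelled
`x`, and `V` is the set of all the state variables chosen. -/
inductive TL {I : Type} [DecidableEq I] : ℕ → Nested I → Finset ℕ → LabSequent I → Prop
  | leaf (x : ℕ) (S : Sequent I) :
      TL x (.node S []) {x} ⟨∅, lab x S.ant, lab x S.suc⟩
  | cons (x y : ℕ) (S : Sequent I) (Λ : List (I × Nested I)) (j : I) (G : Nested I)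
      (V V' : Finset ℕ) (T T' : LabSequent I) :
      TL x (.node S Λ) V T → TL y G V' T' → Disjoint V V' →
      TL x (.node S ((j, G) :: Λ)) (V ∪ V')
        ⟨insert (x, j, y) (T.rel ∪ T'.rel), T.ant + T'.ant, T.suc + T'.suc⟩

end SDML

namespace SDML

/-! ### Kripke semantics -/

/-! The calculi are compared through Kripke models; no derivation in a structured calculus is ever
transformed syntactically into one in `SC`. In a model, `R j ⊆ R i` for `j ≼ i`, and each `R i` is
serial, reflexive or transitive as `F i` demands.

Simulation (`SimClosed.of_SC`): an `SC` derivation can be replayed at any active position of a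
nested, linear or labelled sequent. A modal rule becomes the creation of a successor, followed by
the propagation of formulae into it one at a time.

Soundness (`NS.sound`, `LNS.sound`, `LbNS.sound`): a derivable object fails in no model. Conversely,
an `SC`-underivable sequent fails in the canonical model, whose worlds are saturated pairs over
`SC`-underivable sequents (`canonical_truth`). With the simulation this settles plain sequents.

For an underivable tree, the nodes are saturated from the root downwards with respect to the
predicate "the whole tree is derivable when this node carries `S`". A saturated sequent violating
this predicate is `SC`-underivable by the simulation, hence yields a world of the one canonical
model. Whatever the parent propagates is added to a child before the child is saturated, so the two
worlds are related. Thus the tree fails in the canonical model. The same works for labelled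
sequents, and `TL.labRef` carries refutations of a tree over to its translation. -/

/-- Kripke models of the logic described by `L`. -/
structure Model (L : Description) where
  W : Type
  R : L.Idx → W → W → Prop
  V : ℕ → W → Prop
  mono : ∀ {i j w v}, L.le j i → R j w v → R i w v
  serial : ∀ {i}, L.Has i .D → ∀ w, ∃ v, R i w v
  refl : ∀ {i}, L.Has i .T → ∀ w, R i w w
  trans : ∀ {i w v u}, L.Has i .four → R i w v → R i v u → R i w u

variable {L : Description}

/-- Truth of a formula at a world. -/
def Model.Sat (M : Model L) : M.W → Fml L.Idx → Prop
  | w, .atom p => M.V p w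
  | _, .bot => False
  | w, .and A B => M.Sat w A ∧ M.Sat w B
  | w, .or A B => M.Sat w A ∨ M.Sat w B
  | w, .imp A B => M.Sat w A → M.Sat w B
  | w, .box i A => ∀ v, M.R i w v → M.Sat v A

/-- The sequent `S` fails at the world `w`. -/
def Model.SeqRef (M : Model L) (w : M.W) (S : Sequent L.Idx) : Prop :=
  (∀ A ∈ S.ant, M.Sat w A) ∧ ∀ A ∈ S.suc, ¬ M.Sat w A

/-- For a rule without premises this says that its conclusion cannot fail. -/
theorem Model.seqRef_prop (M : Model L) {w : M.W} {prems : List (Sequent L.Idx)}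
    {S : Sequent L.Idx} (h : PropRule prems S) (hS : M.SeqRef w S) :
    ∃ P ∈ prems, M.SeqRef w P := by
  obtain ⟨h1, h2⟩ := hS
  cases h <;> simp [Model.SeqRef, Model.Sat] at h1 h2 ⊢ <;> tauto

/-! ### Refutation of nested sequents and soundness of `NS` -/

/-- The nested sequent fails at the world `w`. -/
inductive Model.Refuted (M : Model L) : M.W → Nested L.Idx → Prop
  | leaf (w : M.W) (S : Sequent L.Idx) : M.SeqRef w S → M.Refuted w (.node S [])
  | cons (w v : M.W) (S : Sequent L.Idx) (Λ : List (L.Idx × Nested L.Idx)) (j : L.Idx)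
      (G : Nested L.Idx) :
      M.Refuted w (.node S Λ) → M.R j w v → M.Refuted v G → M.Refuted w (.node S ((j, G) :: Λ))

theorem Model.refuted_node (M : Model L) {w : M.W} {S : Sequent L.Idx}
    {Λ : List (L.Idx × Nested L.Idx)} :
    M.Refuted w (.node S Λ) ↔
      M.SeqRef w S ∧ ∀ p ∈ Λ, ∃ v, M.R p.1 w v ∧ M.Refuted v p.2 := by
  induction Λ with
  | nil =>
    constructor
    · rintro (⟨_, _, h⟩ | _)
      exact ⟨h, by simp⟩
    · rintro ⟨h, _⟩
      exact .leaf _ _ h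
  | cons p Λ ih =>
    obtain ⟨j, G⟩ := p
    constructor
    · rintro (_ | ⟨_, v, _, _, _, _, h1, h2, h3⟩)
      obtain ⟨h4, h5⟩ := ih.1 h1
      refine ⟨h4, ?_⟩
      rintro p hp
      rcases List.mem_cons.1 hp with rfl | hp
      · exact ⟨v, h2, h3⟩
      · exact h5 p hp
    · rintro ⟨h1, h2⟩
      obtain ⟨v, hv, hG⟩ := h2 (j, G) (by simp)
      exact .cons _ v _ _ _ _ (ih.2 ⟨h1, fun p hp => h2 p (by simp [hp])⟩) hv hG

/-- The set `Gs` stands for the premises of a rule: which of them fails depends on the world. -/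
theorem Model.refuted_fill (M : Model L) {G : Nested L.Idx} {Gs : Set (Nested L.Idx)}
    (h : ∀ w, M.Refuted w G → ∃ G' ∈ Gs, M.Refuted w G') (U : NCtx L.Idx) :
    ∀ w, M.Refuted w (U.fill G) → ∃ G' ∈ Gs, M.Refuted w (U.fill G') := by
  induction U with
  | hole => exact h
  | node S j C Λ ih =>
    intro w hw
    obtain ⟨h1, h2⟩ := M.refuted_node.1 hw
    obtain ⟨v, hv, hG⟩ := h2 (j, C.fill G) (by simp)
    obtain ⟨G', hG', hr⟩ := ih v hG
    refine ⟨G', hG', M.refuted_node.2 ⟨h1, ?_⟩⟩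
    intro p hp
    rcases List.mem_cons.1 hp with rfl | hp
    · exact ⟨v, hv, hr⟩
    · exact h2 p (by simp [hp])

theorem Model.not_refuted_fill (M : Model L) {G G' : Nested L.Idx} (U : NCtx L.Idx)
    (h : ∀ w, M.Refuted w G → M.Refuted w G') (hU : ∀ w, ¬ M.Refuted w (U.fill G')) :
    ∀ w, ¬ M.Refuted w (U.fill G) := by
  intro w hw
  obtain ⟨_, rfl, h'⟩ := M.refuted_fill (Gs := {G'}) (fun w hw => ⟨G', rfl, h w hw⟩) U w hw
  exact hU w h'

theorem Model.sat_box_of_le_four (M : Model L) {i j : L.Idx} {A : Fml L.Idx} {w v : M.W}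
    (hle : L.le j i) (h4 : L.Has i .four) (hR : M.R j w v) (hA : M.Sat w (.box i A)) :
    M.Sat v (.box i A) :=
  fun u hu => hA u (M.trans h4 (M.mono hle hR) hu)

theorem NS.sound (M : Model L) {G : Nested L.Idx} (h : NS L G) : ∀ w, ¬ M.Refuted w G := by
  induction h with
  | exch U S Λ Λ' hp _ ih =>
    refine M.not_refuted_fill U (fun w hw => ?_) ih
    obtain ⟨h1, h2⟩ := M.refuted_node.1 hw
    exact M.refuted_node.2 ⟨h1, fun p hp' => h2 p (hp.mem_iff.1 hp')⟩
  | prop U Λ prems S hr _ ih =>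
    intro w hw
    obtain ⟨_, ⟨P, hP, rfl⟩, h'⟩ := M.refuted_fill
      (Gs := {G | ∃ P ∈ prems, G = Nested.node P Λ}) (fun w hw => by
        obtain ⟨h1, h2⟩ := M.refuted_node.1 hw
        obtain ⟨P, hP, h3⟩ := M.seqRef_prop hr h1
        exact ⟨_, ⟨P, hP, rfl⟩, M.refuted_node.2 ⟨h3, h2⟩⟩) U w hw
    exact ih P hP w h'
  | boxL U Λ Λ' i j A Γ Δ Θ Ξ hle _ ih =>
    refine M.not_refuted_fill U (fun w hw => ?_) ih
    obtain ⟨h1, h2⟩ := M.refuted_node.1 hw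
    obtain ⟨v, hv, hG⟩ := h2 _ (List.mem_cons_self)
    obtain ⟨h3, h4⟩ := M.refuted_node.1 hG
    refine .cons _ v _ _ _ _ (M.refuted_node.2 ⟨h1, fun p hp => h2 p (by simp [hp])⟩) hv
      (M.refuted_node.2 ⟨⟨?_, h3.2⟩, h4⟩)
    intro B hB
    rcases Multiset.mem_cons.1 hB with rfl | hB
    · exact h1.1 _ (Multiset.mem_cons_self _ _) v (M.mono hle hv)
    · exact h3.1 B hB
  | four U Λ Λ' i j A Γ Δ Θ Ξ hle hf _ ih =>
    refine M.not_refuted_fill U (fun w hw => ?_) ih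
    obtain ⟨h1, h2⟩ := M.refuted_node.1 hw
    obtain ⟨v, hv, hG⟩ := h2 _ (List.mem_cons_self)
    obtain ⟨h3, h4⟩ := M.refuted_node.1 hG
    refine .cons _ v _ _ _ _ (M.refuted_node.2 ⟨h1, fun p hp => h2 p (by simp [hp])⟩) hv
      (M.refuted_node.2 ⟨⟨?_, h3.2⟩, h4⟩)
    intro B hB
    rcases Multiset.mem_cons.1 hB with rfl | hB
    · exact M.sat_box_of_le_four hle hf hv (h1.1 _ (Multiset.mem_cons_self _ _))
    · exact h3.1 B hB
  | boxR U Λ i A Γ Δ _ ih =>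
    refine M.not_refuted_fill U (fun w hw => ?_) ih
    obtain ⟨h1, h2⟩ := M.refuted_node.1 hw
    have := h1.2 _ (Multiset.mem_cons_self _ _)
    simp only [Model.Sat, not_forall] at this
    obtain ⟨v, hv, hA⟩ := this
    exact .cons _ v _ _ _ _
      (M.refuted_node.2 ⟨⟨h1.1, fun B hB => h1.2 B (Multiset.mem_cons_of_mem hB)⟩, h2⟩) hv
      (.leaf _ _ ⟨by simp, by simpa using hA⟩)
  | d U Λ i j A Γ Δ hle hD _ ih =>
    refine M.not_refuted_fill U (fun w hw => ?_) ih
    obtain ⟨v, hv⟩ := M.serial hD w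
    refine .cons _ v _ _ _ _ hw hv (.leaf _ _ ⟨?_, by simp⟩)
    have := (M.refuted_node.1 hw).1.1 _ (Multiset.mem_cons_self _ _) v (M.mono hle hv)
    simpa using this
  | t U Λ i j A Γ Δ hle hT _ ih =>
    refine M.not_refuted_fill U (fun w hw => ?_) ih
    obtain ⟨h1, h2⟩ := M.refuted_node.1 hw
    have hb := h1.1 _ (Multiset.mem_cons_self _ _)
    refine M.refuted_node.2 ⟨⟨?_, h1.2⟩, h2⟩
    intro B hB
    rcases Multiset.mem_cons.1 hB with rfl | hB
    · exact hb
    rcases Multiset.mem_cons.1 hB with rfl | hB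
    · exact hb w (M.mono hle (M.refl hT w))
    · exact h1.1 B (Multiset.mem_cons_of_mem hB)

/-! ### Soundness of `LNS` -/

/-- A linear nested sequent fails along a path that ends in the world `w`. -/
def Model.LinRef (M : Model L) : LinNested L.Idx → M.W → Prop
  | .single S, w => M.SeqRef w S
  | .nest G k S, w => (∃ v, M.LinRef G v ∧ M.R k v w) ∧ M.SeqRef w S
  | .blocked G k S, w => (∃ v, M.LinRef G v ∧ M.R k v w) ∧ M.SeqRef w S

/-- There is a path into `w` along which all components of a linear context fail. -/
def Model.LinCtxRef (M : Model L) : LinCtx L.Idx → M.W → Prop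
  | .empty, _ => True
  | .nest G k, w => ∃ v, M.LinRef G v ∧ M.R k v w

theorem Model.linRef_fill (M : Model L) {U : LinCtx L.Idx} {S : Sequent L.Idx} {w : M.W} :
    M.LinRef (U.fill S) w ↔ M.LinCtxRef U w ∧ M.SeqRef w S := by
  cases U <;> simp [LinCtx.fill, Model.LinRef, Model.LinCtxRef]

theorem LNS.sound (M : Model L) {G : LinNested L.Idx} (h : LNS L G) : ∀ w, ¬ M.LinRef G w := by
  induction h with
  | prop U prems S hr _ ih =>
    intro w hw
    obtain ⟨h1, h2⟩ := M.linRef_fill.1 hw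
    obtain ⟨P, hP, h3⟩ := M.seqRef_prop hr h2
    exact ih P hP w (M.linRef_fill.2 ⟨h1, h3⟩)
  | boxR U i A Γ Δ _ ih =>
    intro w hw
    obtain ⟨h1, h2⟩ := M.linRef_fill.1 hw
    have := h2.2 _ (Multiset.mem_cons_self _ _)
    simp only [Model.Sat, not_forall] at this
    obtain ⟨v, hv, hA⟩ := this
    exact ih v ⟨⟨w, M.linRef_fill.2
      ⟨h1, h2.1, fun B hB => h2.2 B (Multiset.mem_cons_of_mem hB)⟩, hv⟩,
      by simp, by simpa using hA⟩
  | boxL U i j A Γ Δ Θ Ξ hle _ ih =>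
    rintro v ⟨⟨w, hw, hv⟩, h3⟩
    refine ih v ⟨⟨w, hw, hv⟩, ?_, h3.2⟩
    intro B hB
    rcases Multiset.mem_cons.1 hB with rfl | hB
    · exact (M.linRef_fill.1 hw).2.1 _ (Multiset.mem_cons_self _ _) v (M.mono hle hv)
    · exact h3.1 B hB
  | close G k S _ ih => exact ih
  | d U i j A Γ Δ hle hD _ ih =>
    intro w hw
    obtain ⟨v, hv⟩ := M.serial hD w
    refine ih v ⟨⟨w, hw, hv⟩, ?_, by simp⟩
    have := (M.linRef_fill.1 hw).2.1 _ (Multiset.mem_cons_self _ _) v (M.mono hle hv)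
    simpa using this
  | t U i j A Γ Δ hle hT _ ih =>
    intro w hw
    obtain ⟨h0, h1⟩ := M.linRef_fill.1 hw
    have hb := h1.1 _ (Multiset.mem_cons_self _ _)
    refine ih w (M.linRef_fill.2 ⟨h0, ?_, h1.2⟩)
    intro B hB
    rcases Multiset.mem_cons.1 hB with rfl | hB
    · exact hb
    rcases Multiset.mem_cons.1 hB with rfl | hB
    · exact hb w (M.mono hle (M.refl hT w))
    · exact h1.1 B (Multiset.mem_cons_of_mem hB)
  | four U i j A Γ Δ Θ Ξ hle hf _ ih =>
    rintro v ⟨⟨w, hw, hv⟩, h3⟩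
    refine ih v ⟨⟨w, hw, hv⟩, ?_, h3.2⟩
    intro B hB
    rcases Multiset.mem_cons.1 hB with rfl | hB
    · exact M.sat_box_of_le_four hle hf hv
        ((M.linRef_fill.1 hw).2.1 _ (Multiset.mem_cons_self _ _))
    · exact h3.1 B hB

/-! ### Soundness of `LbNS` -/

/-- The labelled sequent `T` fails under the assignment `ρ` of worlds to state variables. -/
structure Model.LabRef (M : Model L) (ρ : ℕ → M.W) (T : LabSequent L.Idx) : Prop where
  rel : ∀ r ∈ T.rel, M.R r.2.1 (ρ r.1) (ρ r.2.2)
  ant : ∀ a ∈ T.ant, M.Sat (ρ a.1) a.2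
  suc : ∀ a ∈ T.suc, ¬ M.Sat (ρ a.1) a.2

theorem Model.labRef_lab (M : Model L) {ρ : ℕ → M.W} {R : Finset (ℕ × L.Idx × ℕ)}
    {X Y : Multiset (ℕ × Fml L.Idx)} {x : ℕ} {S : Sequent L.Idx} :
    M.LabRef ρ ⟨R, X + lab x S.ant, Y + lab x S.suc⟩ ↔
      M.LabRef ρ ⟨R, X, Y⟩ ∧ M.SeqRef (ρ x) S := by
  constructor
  · rintro ⟨h1, h2, h3⟩
    refine ⟨⟨h1, fun a ha => h2 a (Multiset.mem_add.2 (.inl ha)),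
      fun a ha => h3 a (Multiset.mem_add.2 (.inl ha))⟩, fun A hA => ?_, fun A hA => ?_⟩
    · exact h2 (x, A) (Multiset.mem_add.2 (.inr (Multiset.mem_map_of_mem _ hA)))
    · exact h3 (x, A) (Multiset.mem_add.2 (.inr (Multiset.mem_map_of_mem _ hA)))
  · rintro ⟨⟨h1, h2, h3⟩, h4, h5⟩
    refine ⟨h1, fun a ha => ?_, fun a ha => ?_⟩
    · rcases Multiset.mem_add.1 ha with ha | ha
      · exact h2 a ha
      · obtain ⟨A, hA, rfl⟩ := Multiset.mem_map.1 ha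
        exact h4 A hA
    · rcases Multiset.mem_add.1 ha with ha | ha
      · exact h3 a ha
      · obtain ⟨A, hA, rfl⟩ := Multiset.mem_map.1 ha
        exact h5 A hA

theorem Model.LabRef.cons_ant {M : Model L} {ρ : ℕ → M.W} {R : Finset (ℕ × L.Idx × ℕ)}
    {X Y : Multiset (ℕ × Fml L.Idx)} {x : ℕ} {A : Fml L.Idx}
    (h : M.LabRef ρ ⟨R, X, Y⟩) (hA : M.Sat (ρ x) A) : M.LabRef ρ ⟨R, (x, A) ::ₘ X, Y⟩ := by
  refine ⟨h.rel, fun a ha => ?_, h.suc⟩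
  rcases Multiset.mem_cons.1 ha with rfl | ha
  · exact hA
  · exact h.ant a ha

theorem Model.LabRef.cons_suc {M : Model L} {ρ : ℕ → M.W} {R : Finset (ℕ × L.Idx × ℕ)}
    {X Y : Multiset (ℕ × Fml L.Idx)} {x : ℕ} {A : Fml L.Idx}
    (h : M.LabRef ρ ⟨R, X, Y⟩) (hA : ¬ M.Sat (ρ x) A) : M.LabRef ρ ⟨R, X, (x, A) ::ₘ Y⟩ := by
  refine ⟨h.rel, h.ant, fun a ha => ?_⟩
  rcases Multiset.mem_cons.1 ha with rfl | ha
  · exact hA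
  · exact h.suc a ha

theorem Model.LabRef.insert_rel {M : Model L} {ρ : ℕ → M.W} {R : Finset (ℕ × L.Idx × ℕ)}
    {X Y : Multiset (ℕ × Fml L.Idx)} {x y : ℕ} {i : L.Idx}
    (h : M.LabRef ρ ⟨R, X, Y⟩) (hR : M.R i (ρ x) (ρ y)) :
    M.LabRef ρ ⟨insert (x, i, y) R, X, Y⟩ := by
  refine ⟨fun r hr => ?_, h.ant, h.suc⟩
  rcases Finset.mem_insert.1 hr with rfl | hr
  · exact hR
  · exact h.rel r hr

theorem Model.LabRef.congr {M : Model L} {ρ ρ' : ℕ → M.W} {T : LabSequent L.Idx}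
    (h : M.LabRef ρ T) (hr : ∀ r ∈ T.rel, ρ' r.1 = ρ r.1 ∧ ρ' r.2.2 = ρ r.2.2)
    (ha : ∀ a ∈ T.ant, ρ' a.1 = ρ a.1) (hs : ∀ a ∈ T.suc, ρ' a.1 = ρ a.1) : M.LabRef ρ' T := by
  refine ⟨fun r h1 => ?_, fun a h1 => ?_, fun a h1 => ?_⟩
  · rw [(hr r h1).1, (hr r h1).2]
    exact h.rel r h1
  · rw [ha a h1]
    exact h.ant a h1
  · rw [hs a h1]
    exact h.suc a h1

/-- In the rules that create a label, this sends the fresh label to the witnessing successor. -/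
theorem Model.LabRef.update {M : Model L} {ρ : ℕ → M.W} {T : LabSequent L.Idx} {y : ℕ}
    (h : M.LabRef ρ T) (hy : T.Fresh y) (v : M.W) : M.LabRef (Function.update ρ y v) T :=
  h.congr
    (fun r hr => ⟨Function.update_of_ne (hy.1 r hr).1 _ _,
      Function.update_of_ne (hy.1 r hr).2 _ _⟩)
    (fun a ha => Function.update_of_ne (hy.2.1 a ha) _ _)
    (fun a ha => Function.update_of_ne (hy.2.2 a ha) _ _)

theorem LbNS.sound (M : Model L) {T : LabSequent L.Idx} (h : LbNS L T) :
    ∀ ρ, ¬ M.LabRef ρ T := by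
  induction h with
  | prop R X Y x prems S hr _ ih =>
    intro ρ hρ
    obtain ⟨h1, h2⟩ := M.labRef_lab.1 hρ
    obtain ⟨P, hP, h3⟩ := M.seqRef_prop hr h2
    exact ih P hP ρ (M.labRef_lab.2 ⟨h1, h3⟩)
  | boxL R X Y x y i j A hle hxy _ ih =>
    intro ρ hρ
    exact ih ρ (hρ.cons_ant (hρ.ant _ (Multiset.mem_cons_self _ _) _
      (M.mono hle (hρ.rel _ hxy))))
  | boxR R X Y x y i A hy _ ih =>
    intro ρ hρ
    have := hρ.suc _ (Multiset.mem_cons_self _ _)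
    simp only [Model.Sat, not_forall] at this
    obtain ⟨v, hv, hA⟩ := this
    have hx : x ≠ y := hy.2.2 _ (Multiset.mem_cons_self _ _)
    have h' := hρ.update hy v
    refine ih (Function.update ρ y v) (Model.LabRef.insert_rel (Model.LabRef.cons_suc
      ⟨h'.rel, h'.ant, fun a ha => h'.suc a (Multiset.mem_cons_of_mem ha)⟩ ?_) ?_)
    · simpa using hA
    · simpa [Function.update_of_ne hx] using hv
  | d R X Y x y i j A hle hD hy _ ih =>
    intro ρ hρ
    obtain ⟨v, hv⟩ := M.serial hD (ρ x)
    have hA := hρ.ant _ (Multiset.mem_cons_self _ _) v (M.mono hle hv)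
    have hx : x ≠ y := hy.2.1 _ (Multiset.mem_cons_self _ _)
    refine ih (Function.update ρ y v) (((hρ.update hy v).cons_ant ?_).insert_rel ?_)
    · simpa using hA
    · simpa [Function.update_of_ne hx] using hv
  | t R X Y x i j A hle hT _ ih =>
    intro ρ hρ
    exact ih ρ (hρ.cons_ant (hρ.ant _ (Multiset.mem_cons_self _ _) _
      (M.mono hle (M.refl hT _))))
  | four R X Y x y i j A hle hf hxy _ ih =>
    intro ρ hρ
    exact ih ρ (hρ.cons_ant (M.sat_box_of_le_four hle hf (hρ.rel _ hxy)
      (hρ.ant _ (Multiset.mem_cons_self _ _))))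

/-! ### From refuted trees to refuted translations -/

theorem mem_lab {I : Type} {x : ℕ} {Γ : Multiset (Fml I)} {a : ℕ × Fml I} (h : a ∈ lab x Γ) :
    a.1 = x := by
  obtain ⟨A, _, rfl⟩ := Multiset.mem_map.1 h
  rfl

theorem TL.labels {I : Type} [DecidableEq I] {x : ℕ} {U : Nested I} {V : Finset ℕ}
    {T : LabSequent I} (h : TL x U V T) :
    x ∈ V ∧ (∀ r ∈ T.rel, r.1 ∈ V ∧ r.2.2 ∈ V) ∧ (∀ a ∈ T.ant, a.1 ∈ V) ∧
      ∀ a ∈ T.suc, a.1 ∈ V := by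
  induction h with
  | leaf x S => exact ⟨by simp, by simp, fun a ha => by simp [mem_lab ha],
      fun a ha => by simp [mem_lab ha]⟩
  | cons x y S Λ j G V V' T T' _ _ _ ih ih' =>
    obtain ⟨a1, a2, a3, a4⟩ := ih
    obtain ⟨b1, b2, b3, b4⟩ := ih'
    refine ⟨by simp [a1], ?_, ?_, ?_⟩
    · intro r hr
      simp only [Finset.mem_insert, Finset.mem_union] at hr ⊢
      rcases hr with rfl | hr | hr
      · exact ⟨.inl a1, .inr b1⟩
      · exact ⟨.inl (a2 r hr).1, .inl (a2 r hr).2⟩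
      · exact ⟨.inr (b2 r hr).1, .inr (b2 r hr).2⟩
    · intro a ha
      rw [Finset.mem_union]
      exact (Multiset.mem_add.1 ha).imp (a3 a) (b3 a)
    · intro a ha
      rw [Finset.mem_union]
      exact (Multiset.mem_add.1 ha).imp (a4 a) (b4 a)

theorem TL.labRef {M : Model L} {x : ℕ} {U : Nested L.Idx} {V : Finset ℕ}
    {T : LabSequent L.Idx} (h : TL x U V T) :
    ∀ w, M.Refuted w U → ∃ ρ : ℕ → M.W, ρ x = w ∧ M.LabRef ρ T := by
  induction h with
  | leaf x S =>
    intro w hw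
    refine ⟨fun _ => w, rfl, ?_⟩
    have := (M.labRef_lab (R := ∅) (X := 0) (Y := 0) (x := x) (S := S) (ρ := fun _ => w)).2
      ⟨⟨by simp, by simp, by simp⟩, (M.refuted_node.1 hw).1⟩
    simpa using this
  | cons x y S Λ j G V V' T T' h h' hd ih ih' =>
    rintro w (_ | ⟨_, v, _, _, _, _, h1, h2, h3⟩)
    obtain ⟨ρ, rfl, hρ⟩ := ih _ h1
    obtain ⟨ρ', rfl, hρ'⟩ := ih' _ h3
    obtain ⟨a1, a2, a3, a4⟩ := h.labels
    obtain ⟨b1, b2, b3, b4⟩ := h'.labels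
    -- Disjointness of `V` and `V'` makes the glued assignment agree with `ρ` on all of `V`.
    let σ : ℕ → M.W := fun n => if n ∈ V' then ρ' n else ρ n
    have hσ' : ∀ n ∈ V', σ n = ρ' n := fun n hn => if_pos hn
    have hσ : ∀ n ∈ V, σ n = ρ n := fun n hn => if_neg (Finset.disjoint_left.1 hd hn)
    have c := hρ.congr (ρ' := σ) (fun r hr => ⟨hσ _ (a2 r hr).1, hσ _ (a2 r hr).2⟩)
      (fun a ha => hσ _ (a3 a ha)) (fun a ha => hσ _ (a4 a ha))
    have c' := hρ'.congr (ρ' := σ) (fun r hr => ⟨hσ' _ (b2 r hr).1, hσ' _ (b2 r hr).2⟩)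
      (fun a ha => hσ' _ (b3 a ha)) (fun a ha => hσ' _ (b4 a ha))
    refine ⟨σ, hσ x a1, Model.LabRef.insert_rel ⟨?_, ?_, ?_⟩ ?_⟩
    · intro r hr
      exact (Finset.mem_union.1 hr).elim (c.rel r) (c'.rel r)
    · intro a ha
      exact (Multiset.mem_add.1 ha).elim (c.ant a) (c'.ant a)
    · intro a ha
      exact (Multiset.mem_add.1 ha).elim (c.suc a) (c'.suc a)
    · rw [hσ x a1, hσ' y b1]
      exact h2

/-! ### The sequent calculus and its simulation -/

/-- `m` may be copied into the antecedent of an `i`-successor of a node with antecedent `Γ`. -/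
def Propagates (L : Description) (i : L.Idx) (Γ : Set (Fml L.Idx)) (m : Fml L.Idx) : Prop :=
  ∃ k B, Fml.box k B ∈ Γ ∧ L.le i k ∧ (m = B ∨ L.Has k .four ∧ m = .box k B)

theorem Propagates.mono {i : L.Idx} {Γ Γ' : Set (Fml L.Idx)} {m : Fml L.Idx} (h : Γ ⊆ Γ')
    (hm : Propagates L i Γ m) : Propagates L i Γ' m := by
  obtain ⟨k, B, h1, h2⟩ := hm
  exact ⟨k, B, h h1, h2⟩

theorem mem_up {i j : L.Idx} : i ∈ L.up j ↔ L.le j i := by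
  classical
  simp [Description.up]

theorem mem_up4 {i j : L.Idx} : i ∈ L.up4 j ↔ L.le j i ∧ L.Has i .four := by
  classical
  simp [Description.up4, mem_up]

theorem mem_upNot4 {i j : L.Idx} : i ∈ L.upNot4 j ↔ L.le j i ∧ ¬ L.Has i .four := by
  classical
  simp [Description.upNot4, mem_up]

theorem mem_boxes {I : Type} {i : I} {Γ : Multiset (Fml I)} {m : Fml I} :
    m ∈ boxes i Γ ↔ ∃ B ∈ Γ, Fml.box i B = m := Multiset.mem_map

/-- The set of elements of a multiset of formulae. -/
def elems {I : Type} (Γ : Multiset (Fml I)) : Set (Fml I) := {A | A ∈ Γ}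

/-- The simulation needs no more than this about the multisets in the rules `k` and `d`: each
antecedent formula of the premise comes from some box of the conclusion. -/
theorem propagates_premise (i : L.Idx) (Γ Θ : L.Idx → Multiset (Fml L.Idx))
    (Ω : Multiset (Fml L.Idx)) :
    ∀ m ∈ (∑ j ∈ L.up4 i, (boxes j (Γ j) + boxes j (Θ j) + Θ j)) + ∑ j ∈ L.upNot4 i, Θ j,
      Propagates L i (elems (Ω + (∑ j ∈ L.up4 i, (boxes j (Γ j) + boxes j (Θ j))) +
          ∑ j ∈ L.upNot4 i, boxes j (Θ j))) m := by
  intro m hm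
  simp only [Multiset.mem_add, Multiset.mem_sum, Propagates, elems, Set.mem_ofPred_eq,
    mem_boxes] at hm ⊢
  rcases hm with ⟨j, hj, (⟨B, hB, rfl⟩ | ⟨B, hB, rfl⟩) | hB⟩ | ⟨j, hj, hB⟩
  · exact ⟨j, B, .inl (.inr ⟨j, hj, .inl ⟨B, hB, rfl⟩⟩), (mem_up4.1 hj).1,
      .inr ⟨(mem_up4.1 hj).2, rfl⟩⟩
  · exact ⟨j, B, .inl (.inr ⟨j, hj, .inr ⟨B, hB, rfl⟩⟩), (mem_up4.1 hj).1,
      .inr ⟨(mem_up4.1 hj).2, rfl⟩⟩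
  · exact ⟨j, m, .inl (.inr ⟨j, hj, .inr ⟨m, hB, rfl⟩⟩), (mem_up4.1 hj).1, .inl rfl⟩
  · exact ⟨j, m, .inr ⟨j, hj, m, hB, rfl⟩, (mem_upNot4.1 hj).1, .inl rfl⟩

/-- The rule `d` of `SC` may be applied with empty families, whereas the structured calculi need a
principal box to create a successor. A derivable premise with empty succedent has a formula in its
antecedent, and this formula comes from such a box. -/
theorem SC.nonempty {S : Sequent L.Idx} (h : SC L S) : ∃ A, A ∈ S.ant ∨ A ∈ S.suc := by
  induction h with
  | prop prems S hr _ _ => cases hr <;> exact ⟨_, by simp; tauto⟩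
  | k i A Γ Θ Ω Ξ _ _ => exact ⟨.box i A, by simp⟩
  | d i Γ Θ Ω Ξ _ _ ih =>
    obtain ⟨m, hm | hm⟩ := ih
    · obtain ⟨k, B, hB, _⟩ := propagates_premise i Γ Θ Ω m hm
      exact ⟨_, .inl hB⟩
    · simp at hm
  | t i Θ Ω Ξ _ _ ih =>
    obtain ⟨m, hm | hm⟩ := ih
    · simp only [Multiset.mem_add, Multiset.mem_sum, mem_boxes] at hm ⊢
      rcases hm with hm | ⟨j, hj, ⟨B, hB, rfl⟩ | hm⟩
      · exact ⟨m, .inl (.inl hm)⟩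
      · exact ⟨_, .inl (.inr ⟨j, hj, B, hB, rfl⟩)⟩
      · exact ⟨_, .inl (.inr ⟨j, hj, m, hm, rfl⟩)⟩
    · exact ⟨m, .inr hm⟩

/-- The sequent `S` with additional formulae on both sides. -/
def Sequent.weaken {I : Type} (Ω Ξ : Multiset (Fml I)) (S : Sequent I) : Sequent I :=
  ⟨S.ant + Ω, S.suc + Ξ⟩

theorem PropRule.weaken {I : Type} {prems : List (Sequent I)} {S : Sequent I}
    (h : PropRule prems S) (Ω Ξ : Multiset (Fml I)) :
    PropRule (prems.map (Sequent.weaken Ω Ξ)) (S.weaken Ω Ξ) := by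
  cases h <;> simp only [List.map, Sequent.weaken, Multiset.cons_add] <;> constructor

/-- Families of predicates on sequents closed under the rules of the sequent calculus, where a
modal rule may lead from any member of the family to another one. -/
structure SimClosed (L : Description) (𝒟 : (Sequent L.Idx → Prop) → Prop) : Prop where
  prop : ∀ D, 𝒟 D → ∀ prems S, PropRule prems S → (∀ P ∈ prems, D P) → D S
  t : ∀ D, 𝒟 D → ∀ i j A Γ Δ, L.le j i → L.Has j .T →
    D ⟨.box i A ::ₘ A ::ₘ Γ, Δ⟩ → D ⟨.box i A ::ₘ Γ, Δ⟩
  k : ∀ D, 𝒟 D → ∀ i A Γ Δ M, (∀ m ∈ M, Propagates L i (elems Γ) m) →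
    (∀ E, 𝒟 E → E ⟨M, {A}⟩) → D ⟨Γ, .box i A ::ₘ Δ⟩
  d : ∀ D, 𝒟 D → ∀ i k B Γ Δ M, Fml.box k B ∈ Γ → L.le i k → L.Has i .D →
    (∀ m ∈ M, Propagates L i (elems Γ) m) → (∀ E, 𝒟 E → E ⟨B ::ₘ M, 0⟩) → D ⟨Γ, Δ⟩

theorem reflexive_closure {D : Sequent L.Idx → Prop}
    (ht : ∀ i j A Γ Δ, L.le j i → L.Has j .T →
      D ⟨.box i A ::ₘ A ::ₘ Γ, Δ⟩ → D ⟨.box i A ::ₘ Γ, Δ⟩)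
    (Γ Δ M : Multiset (Fml L.Idx))
    (hM : ∀ m ∈ M, ∃ i j, Fml.box i m ∈ Γ ∧ L.le j i ∧ L.Has j .T) :
    D ⟨Γ + M, Δ⟩ → D ⟨Γ, Δ⟩ := by
  induction M using Multiset.induction_on with
  | empty => simp
  | cons m M ih =>
    intro h
    refine ih (fun m' hm' => hM m' (Multiset.mem_cons_of_mem hm')) ?_
    obtain ⟨i, j, hi, hj, hT⟩ := hM m (Multiset.mem_cons_self _ _)
    obtain ⟨Γ', rfl⟩ := Multiset.exists_cons_of_mem hi
    rw [Multiset.add_cons, Multiset.cons_add, Multiset.cons_swap] at h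
    rw [Multiset.cons_add]
    exact ht i j m _ _ hj hT h

/-- Quantifying over all members of the family lets the induction hypothesis be applied at the
successor that a modal rule creates. Weakening is built in because the calculi have no structural
rules. -/
theorem SimClosed.of_SC {𝒟 : (Sequent L.Idx → Prop) → Prop} (h𝒟 : SimClosed L 𝒟)
    {S : Sequent L.Idx} (h : SC L S) :
    ∀ D, 𝒟 D → ∀ Ω Ξ, D (S.weaken Ω Ξ) := by
  induction h with
  | prop prems S hr _ ih =>
    intro D hD Ω Ξ
    refine h𝒟.prop D hD _ _ (hr.weaken Ω Ξ) ?_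
    intro P' hP'
    obtain ⟨P, hP, rfl⟩ := List.mem_map.1 hP'
    exact ih P hP D hD Ω Ξ
  | k i A Γ Θ Ω' Ξ' _ ih =>
    intro D hD Ω Ξ
    have hM := propagates_premise i Γ Θ Ω'
    simp only [Sequent.weaken, Multiset.cons_add]
    refine h𝒟.k D hD i A _ _ _ (fun m hm => (hM m hm).mono ?_) fun E hE => ?_
    · intro a ha
      exact Multiset.mem_add.2 (.inl ha)
    · simpa [Sequent.weaken] using ih E hE 0 0
  | d i Γ Θ Ω' Ξ' hi h ih =>
    intro D hD Ω Ξ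
    have hM := propagates_premise i Γ Θ Ω'
    obtain ⟨m, hm | hm⟩ := h.nonempty
    · obtain ⟨k, B, hB, hik, _⟩ := hM m hm
      refine h𝒟.d D hD i k B _ _ _ (Multiset.mem_add.2 (.inl hB)) hik hi
        (fun m hm => (hM m hm).mono ?_) fun E hE => ?_
      · intro a ha
        exact Multiset.mem_add.2 (.inl ha)
      -- The formula `B` that created the successor may duplicate one in the premise; weakening
      -- absorbs it.
      · have := ih E hE {B} 0
        simpa only [Sequent.weaken, add_zero, Multiset.add_comm _ {B},
          Multiset.singleton_add] using this
    · simp at hm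
  | t i Θ Ω' Ξ' hi _ ih =>
    intro D hD Ω Ξ
    refine reflexive_closure (h𝒟.t D hD) _ _ (∑ j ∈ L.up i, Θ j) ?_ ?_
    · intro m hm
      obtain ⟨j, hj, hm⟩ := Multiset.mem_sum.1 hm
      refine ⟨j, i, ?_, mem_up.1 hj, hi⟩
      simp only [Multiset.mem_add, Multiset.mem_sum]
      exact .inl (.inr ⟨j, hj, Multiset.mem_map_of_mem _ hm⟩)
    · have := ih D hD Ω Ξ
      simp only [Sequent.weaken, Finset.sum_add_distrib] at this
      rwa [add_assoc (Ω' + _), add_comm Ω, ← add_assoc, add_assoc Ω']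

/-! ### Propagation into a successor, and simulation in the three structured calculi -/

/-- Principal boxes remain in the parent, so `Γ` never changes and `M` can be discharged formula by
formula. -/
theorem propagate {i : L.Idx} {Γ : Multiset (Fml L.Idx)} {D : Multiset (Fml L.Idx) → Prop}
    (hL : ∀ k B Γ' Θ, Γ = .box k B ::ₘ Γ' → L.le i k → D (B ::ₘ Θ) → D Θ)
    (h4 : ∀ k B Γ' Θ, Γ = .box k B ::ₘ Γ' → L.le i k → L.Has k .four → D (.box k B ::ₘ Θ) → D Θ)
    (M Θ : Multiset (Fml L.Idx)) (hM : ∀ m ∈ M, Propagates L i (elems Γ) m) :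
    D (M + Θ) → D Θ := by
  induction M using Multiset.induction_on with
  | empty => simp
  | cons m M ih =>
    intro h
    refine ih (fun m' hm' => hM m' (Multiset.mem_cons_of_mem hm')) ?_
    obtain ⟨k, B, hi, hj, hT⟩ := hM m (Multiset.mem_cons_self _ _)
    obtain ⟨Γ', hΓ⟩ := Multiset.exists_cons_of_mem hi
    rw [Multiset.cons_add] at h
    rcases hT with rfl | ⟨hk, rfl⟩
    · exact hL k _ _ _ hΓ hj h
    · exact h4 k _ _ _ hΓ hj hk h

theorem NS.propagate (U : NCtx L.Idx) {i : L.Idx} {Γ Δ Θ Ξ : Multiset (Fml L.Idx)}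
    {Λ Λ' : List (L.Idx × Nested L.Idx)} (M : Multiset (Fml L.Idx))
    (hM : ∀ m ∈ M, Propagates L i (elems Γ) m)
    (h : NS L (U.fill (.node ⟨Γ, Δ⟩ ((i, .node ⟨M + Θ, Ξ⟩ Λ') :: Λ)))) :
    NS L (U.fill (.node ⟨Γ, Δ⟩ ((i, .node ⟨Θ, Ξ⟩ Λ') :: Λ))) := by
  refine SDML.propagate
    (D := fun Θ => NS L (U.fill (.node ⟨Γ, Δ⟩ ((i, .node ⟨Θ, Ξ⟩ Λ') :: Λ)))) ?_ ?_ M Θ hM h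
  · rintro k B Γ' Θ rfl hk h
    exact .boxL U _ _ k i B _ _ _ _ hk h
  · rintro k B Γ' Θ rfl hk h4 h
    exact .four U _ _ k i B _ _ _ _ hk h4 h

theorem LNS.propagate (U : LinCtx L.Idx) {i : L.Idx} {Γ Δ Θ Ξ : Multiset (Fml L.Idx)}
    (M : Multiset (Fml L.Idx)) (hM : ∀ m ∈ M, Propagates L i (elems Γ) m)
    (h : LNS L (.blocked (U.fill ⟨Γ, Δ⟩) i ⟨M + Θ, Ξ⟩)) :
    LNS L (.blocked (U.fill ⟨Γ, Δ⟩) i ⟨Θ, Ξ⟩) := by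
  refine SDML.propagate
    (D := fun Θ => LNS L (.blocked (U.fill ⟨Γ, Δ⟩) i ⟨Θ, Ξ⟩)) ?_ ?_ M Θ hM h
  · rintro k B Γ' Θ rfl hk h
    exact .boxL U k i B _ _ _ _ hk h
  · rintro k B Γ' Θ rfl hk h4 h
    exact .four U k i B _ _ _ _ hk h4 h

theorem lab_cons {I : Type} (x : ℕ) (A : Fml I) (Γ : Multiset (Fml I)) :
    lab x (A ::ₘ Γ) = (x, A) ::ₘ lab x Γ := Multiset.map_cons _ _ _

theorem lab_add {I : Type} (x : ℕ) (Γ Δ : Multiset (Fml I)) :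
    lab x (Γ + Δ) = lab x Γ + lab x Δ := Multiset.map_add _ _ _

theorem LbNS.propagate {R : Finset (ℕ × L.Idx × ℕ)} {X Y : Multiset (ℕ × Fml L.Idx)} {x y : ℕ}
    {i : L.Idx} {Γ : Multiset (Fml L.Idx)} (hR : (x, i, y) ∈ R) (M : Multiset (Fml L.Idx))
    (hM : ∀ m ∈ M, Propagates L i (elems Γ) m)
    (h : LbNS L ⟨R, lab y M + (lab x Γ + X), Y⟩) : LbNS L ⟨R, lab x Γ + X, Y⟩ := by
  have := SDML.propagate (D := fun Θ => LbNS L ⟨R, lab y Θ + (lab x Γ + X), Y⟩) ?_ ?_ M 0 hM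
    (by simpa using h)
  · simpa [lab] using this
  · rintro k B Γ' Θ rfl hk h
    simp only [lab_cons, Multiset.cons_add, Multiset.add_cons] at h ⊢
    rw [Multiset.cons_swap] at h
    exact .boxL R _ Y x y k i B hk hR h
  · rintro k B Γ' Θ rfl hk h4 h
    simp only [lab_cons, Multiset.cons_add, Multiset.add_cons] at h ⊢
    rw [Multiset.cons_swap] at h
    exact .four R _ Y x y k i B hk h4 hR h

/-- Composition of a nested context with a context of depth one. -/
def NCtx.push {I : Type} (T : Sequent I) (k : I) (Λ : List (I × Nested I)) : NCtx I → NCtx I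
  | .hole => .node T k .hole Λ
  | .node S j C Λ' => .node S j (C.push T k Λ) Λ'

theorem NCtx.fill_push {I : Type} (T : Sequent I) (k : I) (Λ : List (I × Nested I)) (U : NCtx I)
    (G : Nested I) : (U.push T k Λ).fill G = U.fill (.node T ((k, G) :: Λ)) := by
  induction U with
  | hole => rfl
  | node S j C Λ' ih => simp [NCtx.push, NCtx.fill, ih]

/-- A member of the family is a node position in a fixed tree; a modal rule moves the hole into the
new child by `NCtx.push`. -/
theorem simClosed_NS (L : Description) :
    SimClosed L fun D => ∃ (U : NCtx L.Idx) (Λ : List (L.Idx × Nested L.Idx)),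
      D = fun S => NS L (U.fill (.node S Λ)) where
  prop := by
    rintro _ ⟨U, Λ, rfl⟩ prems S hr h
    exact .prop U Λ prems S hr h
  t := by
    rintro _ ⟨U, Λ, rfl⟩ i j A Γ Δ hle hT h
    exact .t U Λ i j A Γ Δ hle hT h
  k := by
    rintro _ ⟨U, Λ, rfl⟩ i A Γ Δ M hM h
    refine .boxR U Λ i A Γ Δ (NS.propagate U M hM ?_)
    rw [add_zero, ← NCtx.fill_push]
    exact h _ ⟨_, _, rfl⟩
  d := by
    rintro _ ⟨U, Λ, rfl⟩ i k B Γ Δ M hB hik hD hM h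
    have key : NS L (U.fill (.node ⟨Γ, Δ⟩ ((i, .node ⟨{B}, 0⟩ []) :: Λ))) := by
      refine NS.propagate U M hM ?_
      rw [← NCtx.fill_push, add_comm, Multiset.singleton_add]
      exact h _ ⟨_, _, rfl⟩
    obtain ⟨Γ', rfl⟩ := Multiset.exists_cons_of_mem hB
    exact .d U Λ k i B Γ' Δ hik hD key

theorem simClosed_LNS (L : Description) :
    SimClosed L fun D => ∃ U : LinCtx L.Idx, D = fun S => LNS L (U.fill S) where
  prop := by
    rintro _ ⟨U, rfl⟩ prems S hr h
    exact .prop U prems S hr h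
  t := by
    rintro _ ⟨U, rfl⟩ i j A Γ Δ hle hT h
    exact .t U i j A Γ Δ hle hT h
  k := by
    rintro _ ⟨U, rfl⟩ i A Γ Δ M hM h
    -- Read upwards, all propagation happens while the new component is blocked; only then does
    -- `close` make it active.
    refine .boxR U i A Γ Δ (LNS.propagate U M hM (.close _ _ _ ?_))
    rw [add_zero]
    exact h _ ⟨.nest _ _, rfl⟩
  d := by
    rintro _ ⟨U, rfl⟩ i k B Γ Δ M hB hik hD hM h
    have key : LNS L (.blocked (U.fill ⟨Γ, Δ⟩) i ⟨{B}, 0⟩) := by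
      refine LNS.propagate U M hM (.close _ _ _ ?_)
      rw [add_comm, Multiset.singleton_add]
      exact h _ ⟨.nest _ _, rfl⟩
    obtain ⟨Γ', rfl⟩ := Multiset.exists_cons_of_mem hB
    exact .d U k i B Γ' Δ hik hD key

theorem LabSequent.exists_fresh {I : Type} (T : LabSequent I) : ∃ y, T.Fresh y := by
  classical
  obtain ⟨y, hy⟩ := Infinite.exists_notMem_finset
    (T.rel.image (fun r => r.1) ∪ T.rel.image (fun r => r.2.2) ∪
      (T.ant.map Prod.fst).toFinset ∪ (T.suc.map Prod.fst).toFinset)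
  simp only [Finset.mem_union, Finset.mem_image, Multiset.mem_toFinset, Multiset.mem_map,
    not_or, not_exists, not_and] at hy
  obtain ⟨⟨⟨h1, h2⟩, h3⟩, h4⟩ := hy
  exact ⟨y, fun r hr => ⟨h1 r hr, h2 r hr⟩, h3, h4⟩

theorem simClosed_LbNS (L : Description) :
    SimClosed L fun D => ∃ R X Y x,
      D = fun S => LbNS L ⟨R, X + lab x S.ant, Y + lab x S.suc⟩ where
  prop := by
    rintro _ ⟨R, X, Y, x, rfl⟩ prems S hr h
    exact .prop R X Y x prems S hr h
  t := by
    rintro _ ⟨R, X, Y, x, rfl⟩ i j A Γ Δ hle hT h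
    simp only [lab_cons, Multiset.add_cons] at h ⊢
    refine .t R _ _ x i j A hle hT ?_
    rwa [Multiset.cons_swap]
  k := by
    rintro _ ⟨R, X, Y, x, rfl⟩ i A Γ Δ M hM h
    simp only [lab_cons, Multiset.add_cons]
    obtain ⟨y, hy⟩ :=
      LabSequent.exists_fresh ⟨R, X + lab x Γ, (x, .box i A) ::ₘ (Y + lab x Δ)⟩
    refine .boxR R _ _ x y i A hy ?_
    rw [add_comm X]
    refine LbNS.propagate (i := i) (y := y) (Finset.mem_insert_self _ _) M hM ?_
    have := h _ ⟨insert (x, i, y) R, lab x Γ + X, Y + lab x Δ, y, rfl⟩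
    rw [add_comm (lab y M)]
    simpa [lab, Multiset.add_comm _ {(y, A)}, Multiset.singleton_add] using this
  d := by
    rintro _ ⟨R, X, Y, x, rfl⟩ i k B Γ Δ M hB hik hD hM h
    obtain ⟨y, hy⟩ := LabSequent.exists_fresh ⟨R, X + lab x Γ, Y + lab x Δ⟩
    have key : LbNS L ⟨insert (x, i, y) R, (y, B) ::ₘ (X + lab x Γ), Y + lab x Δ⟩ := by
      rw [add_comm X, ← Multiset.add_cons]
      refine LbNS.propagate (i := i) (y := y) (Finset.mem_insert_self _ _) M hM ?_
      have := h _ ⟨insert (x, i, y) R, lab x Γ + X, Y + lab x Δ, y, rfl⟩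
      simp only [lab_cons, Multiset.add_cons] at this ⊢
      rw [add_comm (lab y M)]
      simpa [lab] using this
    obtain ⟨Γ', rfl⟩ := Multiset.exists_cons_of_mem hB
    simp only [lab_cons, Multiset.add_cons] at key hy ⊢
    exact .d R _ _ x y k i B hik hD hy key

/-! ### The canonical model -/

/-- The demands that a formula in the antecedent makes on a saturated pair `(X, Y)` of sets whose
atoms and boxes are collected in `S`. -/
def AntOK (L : Description) (X Y : Set (Fml L.Idx)) (S : Sequent L.Idx) : Fml L.Idx → Prop
  | .atom p => .atom p ∈ S.ant
  | .bot => False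
  | .and A B => A ∈ X ∧ B ∈ X
  | .or A B => A ∈ X ∨ B ∈ X
  | .imp A B => A ∈ Y ∨ B ∈ X
  | .box i A => .box i A ∈ S.ant ∧ ∀ j, L.le j i → L.Has j .T → A ∈ X

/-- The demands that a formula in the succedent makes on a saturated pair `(X, Y)`. -/
def SucOK (L : Description) (X Y : Set (Fml L.Idx)) (S : Sequent L.Idx) : Fml L.Idx → Prop
  | .atom p => .atom p ∈ S.suc
  | .bot => True
  | .and A B => A ∈ Y ∨ B ∈ Y
  | .or A B => A ∈ Y ∧ B ∈ Y
  | .imp A B => A ∈ X ∧ B ∈ Y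
  | .box i A => .box i A ∈ S.suc

theorem AntOK.mono {X X' Y Y' : Set (Fml L.Idx)} {S : Sequent L.Idx} {A : Fml L.Idx}
    (h : AntOK L X Y S A) (hX : X ⊆ X') (hY : Y ⊆ Y') : AntOK L X' Y' S A := by
  cases A with
  | atom p => exact h
  | bot => exact h
  | and A B => exact ⟨hX h.1, hX h.2⟩
  | or A B => exact Or.imp (@hX _) (@hX _) h
  | imp A B => exact Or.imp (@hY _) (@hX _) h
  | box i A => exact ⟨h.1, fun j h1 h2 => hX (h.2 j h1 h2)⟩

theorem SucOK.mono {X X' Y Y' : Set (Fml L.Idx)} {S : Sequent L.Idx} {A : Fml L.Idx}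
    (h : SucOK L X Y S A) (hX : X ⊆ X') (hY : Y ⊆ Y') : SucOK L X' Y' S A := by
  cases A with
  | atom p => exact h
  | bot => trivial
  | and A B => exact Or.imp (@hY _) (@hY _) h
  | or A B => exact ⟨hY h.1, hY h.2⟩
  | imp A B => exact ⟨hX h.1, hY h.2⟩
  | box i A => exact h

/-- Saturated pairs over an underivable sequent. -/
structure World (L : Description) where
  X : Set (Fml L.Idx)
  Y : Set (Fml L.Idx)
  fin : Sequent L.Idx
  not_SC : ¬ SC L fin
  ant_ok : ∀ A ∈ X, AntOK L X Y fin A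
  suc_ok : ∀ A ∈ Y, SucOK L X Y fin A

/-- The pair `(X, Y)` is saturated over a sequent that lies above `(P, Q)` and violates `D`. -/
structure IsSaturation (D : Sequent L.Idx → Prop) (P Q : Multiset (Fml L.Idx))
    (X Y : Set (Fml L.Idx)) (S : Sequent L.Idx) : Prop where
  not_D : ¬ D S
  le_ant : P ≤ S.ant
  le_suc : Q ≤ S.suc
  ant_ok : ∀ A ∈ X, AntOK L X Y S A
  suc_ok : ∀ A ∈ Y, SucOK L X Y S A

theorem IsSaturation.insert_ant {D : Sequent L.Idx → Prop} {P P' Q : Multiset (Fml L.Idx)}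
    {X Y : Set (Fml L.Idx)} {S : Sequent L.Idx} {A : Fml L.Idx} (h : IsSaturation D P Q X Y S)
    (hP : P' ≤ P) (hA : AntOK L X Y S A) : IsSaturation D P' Q (insert A X) Y S := by
  refine ⟨h.not_D, hP.trans h.le_ant, h.le_suc, ?_, fun B hB =>
    (h.suc_ok B hB).mono (Set.subset_insert _ _) subset_rfl⟩
  rintro B (rfl | hB)
  · exact hA.mono (Set.subset_insert _ _) subset_rfl
  · exact (h.ant_ok B hB).mono (Set.subset_insert _ _) subset_rfl

theorem IsSaturation.insert_suc {D : Sequent L.Idx → Prop} {P Q Q' : Multiset (Fml L.Idx)}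
    {X Y : Set (Fml L.Idx)} {S : Sequent L.Idx} {A : Fml L.Idx} (h : IsSaturation D P Q X Y S)
    (hQ : Q' ≤ Q) (hA : SucOK L X Y S A) : IsSaturation D P Q' X (insert A Y) S := by
  refine ⟨h.not_D, h.le_ant, hQ.trans h.le_suc, fun B hB =>
    (h.ant_ok B hB).mono subset_rfl (Set.subset_insert _ _), ?_⟩
  rintro B (rfl | hB)
  · exact hA.mono subset_rfl (Set.subset_insert _ _)
  · exact (h.suc_ok B hB).mono subset_rfl (Set.subset_insert _ _)

/-- The total size of the formulae in a multiset. -/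
noncomputable def weight {I : Type} (Γ : Multiset (Fml I)) : ℕ := (Γ.map sizeOf).sum

theorem weight_cons {I : Type} (A : Fml I) (Γ : Multiset (Fml I)) :
    weight (A ::ₘ Γ) = sizeOf A + weight Γ := by simp [weight]

/-- `P` and `Q` store formulae already treated, while `Γ` and `Δ` are still to be decomposed and
their weight drops at every step. For a box subject to `t`, the box itself goes to `P` and only its
body returns to `Γ`, so saturation terminates although `t` keeps its principal formula. -/
theorem exists_saturation {D : Sequent L.Idx → Prop}
    (hprop : ∀ prems S, PropRule prems S → (∀ P ∈ prems, D P) → D S)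
    (ht : ∀ i j A Γ Δ, L.le j i → L.Has j .T →
      D ⟨.box i A ::ₘ A ::ₘ Γ, Δ⟩ → D ⟨.box i A ::ₘ Γ, Δ⟩) (n : ℕ) :
    ∀ P Q Γ Δ : Multiset (Fml L.Idx), weight Γ + weight Δ = n → ¬ D ⟨P + Γ, Q + Δ⟩ →
      ∃ X Y S, IsSaturation D P Q X Y S ∧ elems Γ ⊆ X ∧ elems Δ ⊆ Y := by
  induction n using Nat.strong_induction_on with
  | _ n ih =>
  intro P Q Γ Δ hn hD
  have hun : ∀ {S P}, PropRule [P] S → ¬ D S → ¬ D P := fun hr hS hP =>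
    hS (hprop _ _ hr (by simpa using hP))
  have hbin : ∀ {S P P'}, PropRule [P, P'] S → ¬ D S → ¬ D P ∨ ¬ D P' := fun hr hS => by
    by_contra! hc
    exact hS (hprop _ _ hr (by simpa using hc))
  have sub1 : ∀ {A} {Γ : Multiset (Fml L.Idx)} {X}, elems (A ::ₘ Γ) ⊆ X → A ∈ X ∧ elems Γ ⊆ X :=
    fun h => ⟨h (Multiset.mem_cons_self _ _), fun B hB => h (Multiset.mem_cons_of_mem hB)⟩
  have sub2 : ∀ {A} {Γ : Multiset (Fml L.Idx)} {X}, elems Γ ⊆ X → elems (A ::ₘ Γ) ⊆ insert A X :=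
    fun h B hB => (Multiset.mem_cons.1 hB).imp id (@h B)
  rcases Γ.empty_or_exists_mem with rfl | ⟨A, hA⟩
  · rcases Δ.empty_or_exists_mem with rfl | ⟨A, hA⟩
    · refine ⟨∅, ∅, ⟨P, Q⟩, ⟨by simpa using hD, le_rfl, le_rfl, by simp, by simp⟩, ?_, ?_⟩ <;>
        exact fun A hA => absurd hA (Multiset.notMem_zero A)
    · obtain ⟨Δ, rfl⟩ := Multiset.exists_cons_of_mem hA
      rw [Multiset.add_cons] at hD
      rw [weight_cons] at hn
      cases A with
      | atom p =>
        obtain ⟨X, Y, S, h1, h2, h3⟩ := ih (weight (0 : Multiset (Fml L.Idx)) + weight Δ)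
          (by simp at hn; omega) P (.atom p ::ₘ Q) 0 Δ rfl (by rwa [Multiset.cons_add])
        exact ⟨X, insert (Fml.atom p) Y, S, h1.insert_suc (Multiset.le_cons_self _ _)
          (Multiset.mem_of_le h1.le_suc (Multiset.mem_cons_self _ _)), h2, sub2 h3⟩
      | bot =>
        obtain ⟨X, Y, S, h1, h2, h3⟩ := ih (weight (0 : Multiset (Fml L.Idx)) + weight Δ)
          (by simp at hn; omega) P (.bot ::ₘ Q) 0 Δ rfl (by rwa [Multiset.cons_add])
        exact ⟨X, insert Fml.bot Y, S, h1.insert_suc (Multiset.le_cons_self _ _) trivial,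
          h2, sub2 h3⟩
      | and A B =>
        rcases hbin (.andR _ _ A B) hD with h | h
        · obtain ⟨X, Y, S, h1, h2, h3⟩ := ih _
            (by rw [weight_cons]; simp at hn; omega) P Q 0 (A ::ₘ Δ) rfl
            (by rwa [Multiset.add_cons])
          exact ⟨X, insert (Fml.and A B) Y, S, h1.insert_suc le_rfl (.inl (sub1 h3).1),
            h2, sub2 (sub1 h3).2⟩
        · obtain ⟨X, Y, S, h1, h2, h3⟩ := ih _
            (by rw [weight_cons]; simp at hn; omega) P Q 0 (B ::ₘ Δ) rfl
            (by rwa [Multiset.add_cons])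
          exact ⟨X, insert (Fml.and A B) Y, S, h1.insert_suc le_rfl (.inr (sub1 h3).1),
            h2, sub2 (sub1 h3).2⟩
      | or A B =>
        have h := hun (.orR _ _ A B) hD
        obtain ⟨X, Y, S, h1, h2, h3⟩ := ih _
          (by rw [weight_cons, weight_cons]; simp at hn; omega) P Q 0 (A ::ₘ B ::ₘ Δ) rfl
          (by rwa [Multiset.add_cons, Multiset.add_cons])
        exact ⟨X, insert (Fml.or A B) Y, S, h1.insert_suc le_rfl
          ⟨(sub1 h3).1, (sub1 (sub1 h3).2).1⟩, h2,
          sub2 (sub1 (sub1 h3).2).2⟩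
      | imp A B =>
        have h := hun (.impR _ _ A B) hD
        obtain ⟨X, Y, S, h1, h2, h3⟩ := ih _
          (by rw [weight_cons, weight_cons]; simp at hn; omega) P Q (A ::ₘ 0) (B ::ₘ Δ) rfl
          (by rwa [Multiset.add_cons, Multiset.add_cons])
        exact ⟨X, insert (Fml.imp A B) Y, S, h1.insert_suc le_rfl
          ⟨(sub1 h2).1, (sub1 h3).1⟩, (sub1 h2).2,
          sub2 (sub1 h3).2⟩
      | box i A =>
        obtain ⟨X, Y, S, h1, h2, h3⟩ := ih (weight (0 : Multiset (Fml L.Idx)) + weight Δ)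
          (by simp at hn; omega) P (.box i A ::ₘ Q) 0 Δ rfl (by rwa [Multiset.cons_add])
        exact ⟨X, insert (Fml.box i A) Y, S, h1.insert_suc (Multiset.le_cons_self _ _)
          (Multiset.mem_of_le h1.le_suc (Multiset.mem_cons_self _ _)), h2, sub2 h3⟩
  · obtain ⟨Γ, rfl⟩ := Multiset.exists_cons_of_mem hA
    rw [Multiset.add_cons] at hD
    rw [weight_cons] at hn
    cases A with
    | atom p =>
      obtain ⟨X, Y, S, h1, h2, h3⟩ := ih (weight Γ + weight Δ)
        (by simp at hn; omega) (.atom p ::ₘ P) Q Γ Δ rfl (by rwa [Multiset.cons_add])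
      exact ⟨insert (Fml.atom p) X, Y, S, h1.insert_ant (Multiset.le_cons_self _ _)
        (Multiset.mem_of_le h1.le_ant (Multiset.mem_cons_self _ _)), sub2 h2, h3⟩
    | bot => exact absurd (hprop _ _ (.botL _ _) (by simp)) hD
    | and A B =>
      have h := hun (.andL _ _ A B) hD
      obtain ⟨X, Y, S, h1, h2, h3⟩ := ih _
        (by rw [weight_cons, weight_cons]; simp at hn; omega) P Q (A ::ₘ B ::ₘ Γ) Δ rfl
        (by rwa [Multiset.add_cons, Multiset.add_cons])
      exact ⟨insert (Fml.and A B) X, Y, S, h1.insert_ant le_rfl ⟨(sub1 h2).1, (sub1 (sub1 h2).2).1⟩,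
        sub2 (sub1 (sub1 h2).2).2, h3⟩
    | or A B =>
      rcases hbin (.orL _ _ A B) hD with h | h
      · obtain ⟨X, Y, S, h1, h2, h3⟩ := ih _
          (by rw [weight_cons]; simp at hn; omega) P Q (A ::ₘ Γ) Δ rfl
          (by rwa [Multiset.add_cons])
        exact ⟨insert (Fml.or A B) X, Y, S, h1.insert_ant le_rfl (.inl (sub1 h2).1),
          sub2 (sub1 h2).2, h3⟩
      · obtain ⟨X, Y, S, h1, h2, h3⟩ := ih _
          (by rw [weight_cons]; simp at hn; omega) P Q (B ::ₘ Γ) Δ rfl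
          (by rwa [Multiset.add_cons])
        exact ⟨insert (Fml.or A B) X, Y, S, h1.insert_ant le_rfl (.inr (sub1 h2).1),
          sub2 (sub1 h2).2, h3⟩
    | imp A B =>
      rcases hbin (.impL _ _ A B) hD with h | h
      · obtain ⟨X, Y, S, h1, h2, h3⟩ := ih _
          (by rw [weight_cons]; simp at hn; omega) P Q Γ (A ::ₘ Δ) rfl
          (by rwa [Multiset.add_cons])
        exact ⟨insert (Fml.imp A B) X, Y, S, h1.insert_ant le_rfl (.inl (sub1 h3).1),
          sub2 h2, (sub1 h3).2⟩
      · obtain ⟨X, Y, S, h1, h2, h3⟩ := ih _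
          (by rw [weight_cons]; simp at hn; omega) P Q (B ::ₘ Γ) Δ rfl
          (by rwa [Multiset.add_cons])
        exact ⟨insert (Fml.imp A B) X, Y, S, h1.insert_ant le_rfl (.inr (sub1 h2).1),
          sub2 (sub1 h2).2, h3⟩
    | box i A =>
      by_cases hT : ∃ j, L.le j i ∧ L.Has j .T
      · obtain ⟨j, hj, hT⟩ := hT
        have h := fun h => hD (ht i j A _ _ hj hT h)
        obtain ⟨X, Y, S, h1, h2, h3⟩ := ih _
          (by rw [weight_cons]; simp at hn; omega) (.box i A ::ₘ P) Q (A ::ₘ Γ) Δ rfl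
          (by rwa [Multiset.add_cons, Multiset.cons_add, Multiset.cons_swap])
        exact ⟨insert (Fml.box i A) X, Y, S, h1.insert_ant (Multiset.le_cons_self _ _)
          ⟨Multiset.mem_of_le h1.le_ant (Multiset.mem_cons_self _ _), fun _ _ _ => (sub1 h2).1⟩,
          sub2 (sub1 h2).2, h3⟩
      · obtain ⟨X, Y, S, h1, h2, h3⟩ := ih (weight Γ + weight Δ)
          (by simp at hn; omega) (.box i A ::ₘ P) Q Γ Δ rfl (by rwa [Multiset.cons_add])
        exact ⟨insert (Fml.box i A) X, Y, S, h1.insert_ant (Multiset.le_cons_self _ _)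
          ⟨Multiset.mem_of_le h1.le_ant (Multiset.mem_cons_self _ _),
            fun j hj hTj => absurd ⟨j, hj, hTj⟩ hT⟩, sub2 h2, h3⟩

/-- The sequent `S` is contained in the world `w`. -/
def World.Contains (w : World L) (S : Sequent L.Idx) : Prop :=
  elems S.ant ⊆ w.X ∧ elems S.suc ⊆ w.Y

/-- Since `SC` is contained in `D`, saturations for different calculi and contexts all give worlds
of the same model. The stronger fact `¬ D w.fin` is kept in order to continue with the children of a
node. -/
theorem exists_world {D : Sequent L.Idx → Prop}
    (hprop : ∀ prems S, PropRule prems S → (∀ P ∈ prems, D P) → D S)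
    (ht : ∀ i j A Γ Δ, L.le j i → L.Has j .T →
      D ⟨.box i A ::ₘ A ::ₘ Γ, Δ⟩ → D ⟨.box i A ::ₘ Γ, Δ⟩)
    (hSC : ∀ S, SC L S → D S) {S : Sequent L.Idx} (hS : ¬ D S) :
    ∃ w : World L, w.Contains S ∧ ¬ D w.fin := by
  obtain ⟨X, Y, S', h1, h2, h3⟩ := exists_saturation hprop ht _ 0 0 S.ant S.suc rfl (by simpa)
  exact ⟨⟨X, Y, S', fun h => h1.not_D (hSC _ h), h1.ant_ok, h1.suc_ok⟩, ⟨h2, h3⟩, h1.not_D⟩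

theorem SimClosed.exists_world {𝒟 : (Sequent L.Idx → Prop) → Prop} (h𝒟 : SimClosed L 𝒟)
    {D : Sequent L.Idx → Prop} (hD : 𝒟 D) {S : Sequent L.Idx} (hS : ¬ D S) :
    ∃ w : World L, w.Contains S ∧ ¬ D w.fin :=
  SDML.exists_world (h𝒟.prop D hD) (h𝒟.t D hD)
    (fun S h => by simpa [Sequent.weaken] using h𝒟.of_SC h D hD 0 0) hS

/-! ### Maximal instances of the modal rules -/

/-- The family `f` with the formula `B` added at the index `k`. -/
def addAt [DecidableEq L.Idx] (f : L.Idx → Multiset (Fml L.Idx)) (k : L.Idx) (B : Fml L.Idx)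
    (j : L.Idx) : Multiset (Fml L.Idx) := f j + if j = k then {B} else 0

theorem sum_boxes_addAt [DecidableEq L.Idx] (s : Finset L.Idx) (f : L.Idx → Multiset (Fml L.Idx))
    (k : L.Idx) (B : Fml L.Idx) :
    ∑ j ∈ s, boxes j (addAt f k B j) =
      (∑ j ∈ s, boxes j (f j)) + if k ∈ s then {Fml.box k B} else 0 := by
  have : ∀ j, boxes j (addAt f k B j) = boxes j (f j) + if j = k then {Fml.box k B} else 0 := by
    intro j
    by_cases h : j = k
    · subst h
      simp [boxes, addAt]
    · simp [boxes, addAt, h]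
  simp [this, Finset.sum_add_distrib]

theorem sum_addAt [DecidableEq L.Idx] (s : Finset L.Idx) (f : L.Idx → Multiset (Fml L.Idx))
    (k : L.Idx) (B : Fml L.Idx) :
    ∑ j ∈ s, addAt f k B j = (∑ j ∈ s, f j) + if k ∈ s then {B} else 0 := by
  simp [addAt, Finset.sum_add_distrib]

/-- Every box with index above `i` goes into the family `Θ`, everything else into `Ω`. -/
theorem exists_modal_decomposition (L : Description) (i : L.Idx) (Γ : Multiset (Fml L.Idx)) :
    ∃ (Θ : L.Idx → Multiset (Fml L.Idx)) (Ω : Multiset (Fml L.Idx)),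
      Γ = Ω + (∑ j ∈ L.up4 i, boxes j (Θ j)) + ∑ j ∈ L.upNot4 i, boxes j (Θ j) ∧
      ∀ k B, Fml.box k B ∈ Γ → L.le i k → B ∈ Θ k := by
  classical
  induction Γ using Multiset.induction_on with
  | empty => exact ⟨0, 0, by simp [boxes], by simp⟩
  | cons A Γ ih =>
    obtain ⟨Θ, Ω, h1, h2⟩ := ih
    by_cases hA : ∃ k B, A = Fml.box k B ∧ L.le i k
    · obtain ⟨k, B, rfl, hk⟩ := hA
      refine ⟨addAt Θ k B, Ω, ?_, ?_⟩
      · rw [sum_boxes_addAt, sum_boxes_addAt, h1, ← Multiset.singleton_add]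
        by_cases h4 : L.Has k .four
        · rw [if_pos (mem_up4.2 ⟨hk, h4⟩), if_neg (fun h => (mem_upNot4.1 h).2 h4)]
          abel
        · rw [if_pos (mem_upNot4.2 ⟨hk, h4⟩), if_neg (fun h => h4 (mem_up4.1 h).2)]
          abel
      · intro k' B' hB hk'
        rcases Multiset.mem_cons.1 hB with hB | hB
        · cases hB
          simp [addAt]
        · simp [addAt, h2 k' B' hB hk']
    · refine ⟨Θ, A ::ₘ Ω, ?_, ?_⟩
      · rw [Multiset.cons_add, Multiset.cons_add, ← h1]
      · intro k' B' hB hk'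
        rcases Multiset.mem_cons.1 hB with hB | hB
        · exact absurd ⟨k', B', hB.symm, hk'⟩ hA
        · exact h2 k' B' hB hk'

/-- The rule is applied with the largest possible `Θ` and with the other family empty. Its premise
then holds exactly what canonical accessibility demands of a successor. -/
theorem exists_modal_premise (L : Description) (i : L.Idx) (Γ : Multiset (Fml L.Idx)) :
    ∃ M : Multiset (Fml L.Idx), (∀ m, m ∈ M ↔ Propagates L i (elems Γ) m) ∧
      (∀ A Ξ, SC L ⟨M, {A}⟩ → SC L ⟨Γ, .box i A ::ₘ Ξ⟩) ∧
      (∀ Ξ, L.Has i .D → SC L ⟨M, 0⟩ → SC L ⟨Γ, Ξ⟩) := by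
  obtain ⟨Θ, Ω, h1, h2⟩ := exists_modal_decomposition L i Γ
  have e : Γ = Ω + (∑ j ∈ L.up4 i, (boxes j 0 + boxes j (Θ j))) +
      ∑ j ∈ L.upNot4 i, boxes j (Θ j) := by simpa [boxes] using h1
  refine ⟨(∑ j ∈ L.up4 i, (boxes j 0 + boxes j (Θ j) + Θ j)) + ∑ j ∈ L.upNot4 i, Θ j,
    fun m => ⟨fun hm => ?_, ?_⟩, fun A Ξ h => ?_, fun Ξ hD h => ?_⟩
  · rw [e]
    exact propagates_premise i (fun _ => 0) Θ Ω m hm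
  · rintro ⟨k, B, hB, hk, hm⟩
    have hB' := h2 k B hB hk
    simp only [Multiset.mem_add, Multiset.mem_sum, mem_boxes]
    by_cases h4 : L.Has k .four
    · refine .inl ⟨k, mem_up4.2 ⟨hk, h4⟩, ?_⟩
      rcases hm with rfl | ⟨_, rfl⟩
      · exact .inr hB'
      · exact .inl (.inr ⟨B, hB', rfl⟩)
    · rcases hm with rfl | ⟨h, _⟩
      · exact .inr ⟨k, mem_upNot4.2 ⟨hk, h4⟩, hB'⟩
      · exact absurd h h4
  · rw [e]
    exact .k i A (fun _ => 0) Θ Ω Ξ h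
  · rw [e]
    exact .d i (fun _ => 0) Θ Ω Ξ hD h

/-- This is the rule `t` of `SC` at `j` for the family concentrated at `i` with the single formula
`A`. -/
theorem SC.reflexive {i j : L.Idx} {A : Fml L.Idx} {Γ Δ : Multiset (Fml L.Idx)}
    (hle : L.le j i) (hT : L.Has j .T) (h : SC L ⟨.box i A ::ₘ A ::ₘ Γ, Δ⟩) :
    SC L ⟨.box i A ::ₘ Γ, Δ⟩ := by
  classical
  have e1 := sum_boxes_addAt (L.up j) 0 i A
  have e2 := sum_addAt (L.up j) 0 i A
  rw [if_pos (mem_up.2 hle)] at e1 e2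
  simp only [Pi.zero_apply, boxes, Multiset.map_zero, Finset.sum_const_zero, zero_add] at e1 e2
  have := SC.t j (addAt 0 i A) Γ Δ hT
  simp only [Finset.sum_add_distrib, boxes, e1, e2] at this
  rw [← Multiset.singleton_add, add_comm]
  refine this ?_
  rwa [add_comm, add_assoc, Multiset.singleton_add, Multiset.singleton_add]

theorem SC.exists_world {S : Sequent L.Idx} (hS : ¬ SC L S) : ∃ w : World L, w.Contains S := by
  obtain ⟨w, hw, _⟩ := SDML.exists_world (D := SC L) (fun prems S hr h => .prop prems S hr h)
    (fun i j A Γ Δ hle hT h => h.reflexive hle hT) (fun _ h => h) hS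
  exact ⟨w, hw⟩

/-- Canonical accessibility. -/
def World.Rel (i : L.Idx) (w v : World L) : Prop := ∀ m, Propagates L i w.X m → m ∈ v.X

/-- Saturation puts every box of `w.X` into `w.fin.ant`, so the finite sequent already decides what
has to be propagated. -/
theorem World.rel_of_fin {i : L.Idx} {w v : World L}
    (h : ∀ m, Propagates L i (elems w.fin.ant) m → m ∈ v.X) : World.Rel i w v := by
  rintro m ⟨k, B, hB, hm⟩
  exact h m ⟨k, B, (w.ant_ok _ hB).1, hm⟩

/-- The canonical model. -/
def canonical (L : Description) : Model L where
  W := World L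
  R := World.Rel
  V p w := Fml.atom p ∈ w.X
  mono := by
    rintro i j w v hle h m ⟨k, B, hB, hk, hm⟩
    exact h m ⟨k, B, hB, L.le_trans _ _ _ hle hk, hm⟩
  serial := by
    intro i hD w
    obtain ⟨M, h1, _, h3⟩ := exists_modal_premise L i w.fin.ant
    obtain ⟨v, hv⟩ := SC.exists_world (fun h => w.not_SC (h3 w.fin.suc hD h))
    exact ⟨v, World.rel_of_fin fun m hm => hv.1 ((h1 m).2 hm)⟩
  refl := by
    rintro i hT w m ⟨k, B, hB, hk, rfl | ⟨_, rfl⟩⟩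
    · exact (w.ant_ok _ hB).2 i hk hT
    · exact hB
  trans := by
    rintro i w v u h4 h1 h2 m ⟨k, B, hB, hk, hm⟩
    -- Transitive-closedness gives `4` at every `k` above `i`, so the box itself reaches `v` and
    -- propagates from there.
    exact h2 m ⟨k, B, h1 _ ⟨k, B, hB, hk, .inr ⟨L.transClosed _ _ hk h4, rfl⟩⟩, hk, hm⟩

/-- The two claims are one-sided because a formula may lie in neither `w.X` nor `w.Y`. -/
theorem canonical_truth (A : Fml L.Idx) : ∀ w : World L,
    (A ∈ w.X → (canonical L).Sat w A) ∧ (A ∈ w.Y → ¬ (canonical L).Sat w A) := by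
  induction A with
  | atom p =>
    refine fun w => ⟨id, fun hY hX => w.not_SC ?_⟩
    have h1 : Fml.atom p ∈ w.fin.ant := w.ant_ok _ hX
    have h2 : Fml.atom p ∈ w.fin.suc := w.suc_ok _ hY
    obtain ⟨Γ, hΓ⟩ := Multiset.exists_cons_of_mem h1
    obtain ⟨Δ, hΔ⟩ := Multiset.exists_cons_of_mem h2
    have e : w.fin = ⟨.atom p ::ₘ Γ, .atom p ::ₘ Δ⟩ := by rw [← hΓ, ← hΔ]
    rw [e]
    exact .prop _ _ (.init Γ Δ p) (by simp)
  | bot => exact fun w => ⟨fun h => (w.ant_ok _ h).elim, fun _ h => h⟩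
  | and A B hA hB =>
    refine fun w => ⟨fun h => ?_, fun h => ?_⟩
    · exact ⟨(hA w).1 (w.ant_ok _ h).1, (hB w).1 (w.ant_ok _ h).2⟩
    · rintro ⟨h1, h2⟩
      exact (w.suc_ok _ h).elim (fun h => (hA w).2 h h1) (fun h => (hB w).2 h h2)
  | or A B hA hB =>
    refine fun w => ⟨fun h => ?_, fun h => ?_⟩
    · exact Or.imp (hA w).1 (hB w).1 (w.ant_ok _ h)
    · rintro (h1 | h1)
      · exact (hA w).2 (w.suc_ok _ h).1 h1
      · exact (hB w).2 (w.suc_ok _ h).2 h1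
  | imp A B hA hB =>
    refine fun w => ⟨fun h h1 => ?_, fun h h1 => ?_⟩
    · exact (w.ant_ok _ h).elim (fun h => absurd h1 ((hA w).2 h)) (hB w).1
    · exact (hB w).2 (w.suc_ok _ h).2 (h1 ((hA w).1 (w.suc_ok _ h).1))
  | box i A hA =>
    refine fun w => ⟨fun h v hv => ?_, fun h h1 => ?_⟩
    · exact (hA v).1 (hv A ⟨i, A, h, L.le_refl i, .inl rfl⟩)
    · obtain ⟨M, p1, p2, _⟩ := exists_modal_premise L i w.fin.ant
      have h2 : Fml.box i A ∈ w.fin.suc := w.suc_ok _ h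
      obtain ⟨Δ, hΔ⟩ := Multiset.exists_cons_of_mem h2
      have e : w.fin = ⟨w.fin.ant, .box i A ::ₘ Δ⟩ := by rw [← hΔ]
      obtain ⟨v, hv⟩ := SC.exists_world (fun h => w.not_SC (e ▸ p2 A Δ h))
      exact (hA v).2 (hv.2 (Multiset.mem_singleton_self A))
        (h1 v (World.rel_of_fin fun m hm => hv.1 ((p1 m).2 hm)))

theorem World.Contains.seqRef {w : World L} {S : Sequent L.Idx} (h : w.Contains S) :
    (canonical L).SeqRef w S :=
  ⟨fun A hA => (canonical_truth A w).1 (h.1 hA), fun A hA => (canonical_truth A w).2 (h.2 hA)⟩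

/-! ### Completeness on trees -/

/-- Peeling off the first nesting matches the constructors of `Model.Refuted` and `TL`. -/
theorem Nested.leaf_cons_induction {I : Type} {P : Nested I → Prop}
    (leaf : ∀ S, P (.node S []))
    (cons : ∀ S j G Λ, P (.node S Λ) → P G → P (.node S ((j, G) :: Λ))) : ∀ U, P U
  | .node S [] => leaf S
  | .node S ((j, G) :: Λ) => cons S j G Λ (Nested.leaf_cons_induction leaf cons (.node S Λ))
      (Nested.leaf_cons_induction leaf cons G)
termination_by U => sizeOf U
decreasing_by all_goals simp; try omega

/-- The root is already saturated to `w`; `Λ'` collects the nestings already peeled off, which stay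
in the tree as context. -/
theorem NS.refuted_of_not_children (U : Nested L.Idx) :
    ∀ S Λ, U = .node S Λ → ∀ (w : World L) (C : NCtx L.Idx) (Λ' : List (L.Idx × Nested L.Idx)),
      w.Contains S → ¬ NS L (C.fill (.node w.fin (Λ ++ Λ'))) → (canonical L).Refuted w U := by
  induction U using Nested.leaf_cons_induction with
  | leaf S =>
    rintro _ _ ⟨⟩ w C Λ' hw _
    exact .leaf _ _ hw.seqRef
  | cons S j G Λ ih ih' =>
    rintro _ _ ⟨⟩ w C Λ' hw h
    obtain ⟨S', Λ₁⟩ := G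
    obtain ⟨M, hM, _⟩ := exists_modal_premise L j w.fin.ant
    -- Loading the child with all of `M` keeps the tree underivable, since propagation could remove
    -- `M` again.
    have h1 : ¬ NS L ((C.push w.fin j (Λ ++ Λ')).fill (.node ⟨M + S'.ant, S'.suc⟩ Λ₁)) := by
      rw [NCtx.fill_push]
      exact fun hc => h (NS.propagate C M (fun m hm => (hM m).1 hm) hc)
    obtain ⟨v, hv, h2⟩ := (simClosed_NS L).exists_world
      (D := fun S => NS L ((C.push w.fin j (Λ ++ Λ')).fill (.node S Λ₁))) ⟨_, _, rfl⟩ h1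
    -- The remaining siblings are treated in the original tree with this child unsaturated, so the
    -- branches do not interact.
    refine Model.Refuted.cons (M := canonical L) w v S Λ j _
      (ih S Λ rfl w C ((j, .node S' Λ₁) :: Λ') hw fun hc => h ?_) ?_
      (ih' S' Λ₁ rfl v (C.push w.fin j (Λ ++ Λ')) [] ?_ ?_)
    · exact .exch C _ _ _ List.perm_middle hc
    · exact World.rel_of_fin fun m hm =>
        hv.1 (Multiset.mem_add.2 (.inl ((hM m).2 hm)))
    · exact ⟨fun A hA => hv.1 (Multiset.mem_add.2 (.inr hA)), hv.2⟩
    · rwa [List.append_nil]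

theorem NS.refuted_of_not {U : Nested L.Idx} (h : ¬ NS L U) :
    ∃ w, (canonical L).Refuted w U := by
  obtain ⟨S, Λ⟩ := U
  obtain ⟨w, hw, h1⟩ := (simClosed_NS L).exists_world
    (D := fun S => NS L (NCtx.hole.fill (.node S Λ))) ⟨_, _, rfl⟩ h
  exact ⟨w, NS.refuted_of_not_children _ S Λ rfl w .hole [] hw (by rwa [List.append_nil])⟩

/-- `Xc` and `Yc` carry the formulae of the proper descendants of the root, while `R`, `X` and `Y`
leave room for ancestors and other branches of a larger labelled sequent. -/
theorem LbNS.refuted_of_not_children {x : ℕ} {U : Nested L.Idx} {V : Finset ℕ}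
    {T : LabSequent L.Idx} (h : TL x U V T) :
    ∃ S Λ Xc Yc, U = .node S Λ ∧ T.ant = lab x S.ant + Xc ∧ T.suc = lab x S.suc + Yc ∧
      ∀ (w : World L) (R : Finset (ℕ × L.Idx × ℕ)) (X Y : Multiset (ℕ × Fml L.Idx)),
        T.rel ⊆ R → w.Contains S → ¬ LbNS L ⟨R, lab x w.fin.ant + (X + Xc), Y + Yc⟩ →
        (canonical L).Refuted w U := by
  induction h with
  | leaf x S =>
    exact ⟨S, [], 0, 0, rfl, by simp, by simp, fun w R X Y _ hw _ => .leaf _ _ hw.seqRef⟩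
  | cons x y S Λ j G V V' T T' _ _ _ ih ih' =>
    obtain ⟨_, _, Xc, Yc, ⟨⟩, e1, e2, ih⟩ := ih
    obtain ⟨S', Λ₁, Xc', Yc', rfl, e1', e2', ih'⟩ := ih'
    refine ⟨S, _, Xc + T'.ant, Yc + T'.suc, rfl, ?_, ?_, ?_⟩
    · rw [e1, add_assoc]
    · rw [e2, add_assoc]
    intro w R X Y hR hw h
    obtain ⟨M, hM, _⟩ := exists_modal_premise L j w.fin.ant
    have hxy : (x, j, y) ∈ R := hR (Finset.mem_insert_self _ _)
    -- As for trees, the child is loaded with everything that propagates from `w` before it is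
    -- saturated.
    have h1 : ¬ LbNS L ⟨R, (lab x w.fin.ant + (X + Xc + Xc')) + lab y (M + S'.ant),
        (Y + Yc + Yc') + lab y S'.suc⟩ := by
      intro hc
      refine h (LbNS.propagate hxy M (fun m hm => (hM m).1 hm) ?_)
      rw [e1', e2']
      convert hc using 2
      · rw [lab_add]
        ac_rfl
      · ac_rfl
    obtain ⟨v, hv, h2⟩ := (simClosed_LbNS L).exists_world
      (D := fun S => LbNS L ⟨R, (lab x w.fin.ant + (X + Xc + Xc')) + lab y S.ant,
        (Y + Yc + Yc') + lab y S.suc⟩) ⟨_, _, _, _, rfl⟩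
      (S := ⟨M + S'.ant, S'.suc⟩) h1
    refine Model.Refuted.cons (M := canonical L) w v S Λ j _
      (ih w R (X + T'.ant) (Y + T'.suc) ?_ hw fun hc => h ?_) ?_
      (ih' v R (lab x w.fin.ant + (X + Xc)) (Y + Yc + lab y v.fin.suc) ?_ ?_ fun hc => h2 ?_)
    · exact fun r hr => hR (Finset.mem_insert_of_mem (Finset.mem_union_left _ hr))
    · convert hc using 2 <;> ac_rfl
    · exact World.rel_of_fin fun m hm =>
        hv.1 (Multiset.mem_add.2 (.inl ((hM m).2 hm)))
    · exact fun r hr => hR (Finset.mem_insert_of_mem (Finset.mem_union_right _ hr))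
    · exact ⟨fun A hA => hv.1 (Multiset.mem_add.2 (.inr hA)), hv.2⟩
    · convert hc using 2 <;> ac_rfl

theorem LbNS.refuted_of_not {x : ℕ} {U : Nested L.Idx} {V : Finset ℕ} {T : LabSequent L.Idx}
    (hT : TL x U V T) (h : ¬ LbNS L T) : ∃ w, (canonical L).Refuted w U := by
  obtain ⟨S, Λ, Xc, Yc, rfl, e1, e2, hr⟩ := LbNS.refuted_of_not_children hT
  have h1 : ¬ LbNS L ⟨T.rel, Xc + lab x S.ant, Yc + lab x S.suc⟩ := by
    rwa [add_comm Xc, add_comm Yc, ← e1, ← e2]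
  obtain ⟨w, hw, h2⟩ := (simClosed_LbNS L).exists_world
    (D := fun S => LbNS L ⟨T.rel, Xc + lab x S.ant, Yc + lab x S.suc⟩) ⟨_, _, _, _, rfl⟩ h1
  refine ⟨w, hr w T.rel 0 (lab x w.fin.suc) subset_rfl hw fun hc => h2 ?_⟩
  rwa [zero_add, add_comm, add_comm (lab x w.fin.suc)] at hc

/-! ### The equivalences -/

/-- Underivability on either side yields a canonical countermodel of the tree `U`, which contradicts
soundness on the other side: directly for `NS`, through `TL.labRef` for `LbNS`. -/
theorem NS_iff_LbNS {x : ℕ} {U : Nested L.Idx} {V : Finset ℕ} {T : LabSequent L.Idx}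
    (hT : TL x U V T) : NS L U ↔ LbNS L T := by
  constructor
  · intro h
    by_contra hc
    obtain ⟨w, hw⟩ := LbNS.refuted_of_not hT hc
    exact h.sound _ w hw
  · intro h
    by_contra hc
    obtain ⟨w, hw⟩ := NS.refuted_of_not hc
    obtain ⟨ρ, _, hρ⟩ := hT.labRef w hw
    exact h.sound _ ρ hρ

/-- Left to right is semantic, by soundness and the canonical model; right to left is the
simulation. -/
theorem NS_iff_SC (S : Sequent L.Idx) : NS L (.node S []) ↔ SC L S := by
  constructor
  · intro h
    by_contra hc
    obtain ⟨w, hw⟩ := SC.exists_world hc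
    exact h.sound (canonical L) w (.leaf _ _ hw.seqRef)
  · intro h
    simpa [Sequent.weaken, NCtx.fill] using (simClosed_NS L).of_SC h _ ⟨.hole, [], rfl⟩ 0 0

theorem LNS_iff_SC (S : Sequent L.Idx) : LNS L (.single S) ↔ SC L S := by
  constructor
  · intro h
    by_contra hc
    obtain ⟨w, hw⟩ := SC.exists_world hc
    exact h.sound (canonical L) w hw.seqRef
  · intro h
    simpa [Sequent.weaken, LinCtx.fill] using (simClosed_LNS L).of_SC h _ ⟨.empty, rfl⟩ 0 0

end SDML

theorem mainTheorem3 (L : SDML.Description) :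
    (∀ (S : SDML.Sequent L.Idx) (x : ℕ),
      List.TFAE
        [SDML.NS L (.node S []),
         SDML.LNS L (.single S),
         SDML.SC L S,
         SDML.LbNS L ⟨∅, SDML.lab x S.ant, SDML.lab x S.suc⟩]) ∧
    (∀ (x : ℕ) (U : SDML.Nested L.Idx) (V : Finset ℕ) (T : SDML.LabSequent L.Idx),
      SDML.TL x U V T → (SDML.NS L U ↔ SDML.LbNS L T)) := by
  refine ⟨fun S x => ?_, fun x U V T hT => SDML.NS_iff_LbNS hT⟩
  tfae_have 1 ↔ 3 := SDML.NS_iff_SC S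
  tfae_have 2 ↔ 3 := SDML.LNS_iff_SC S
  tfae_have 1 ↔ 4 := SDML.NS_iff_LbNS (.leaf x S)
  tfae_finish
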